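/- Let $q\in C^1[0,1]$ be real valued with $\int_0^1 q(x)\,dx=0$, let $h,H\in\mathbb R$, let $\gamma_0,\gamma_1$ be nonzero real numbers, and let $\xi_0=p_0/r_0$, $\xi_1=p_1/r_1$ be rational numbers in $(0,1)$ with positive integers $p_i,r_i$. Consider the problem $$-y''+q(x)y=\lambda y\ \text{ on }(0,1),\qquad y'(0)+hy(0)-\gamma_0y(\xi_0)=0,\qquad y'(1)+Hy(1)-\gamma_1y(\xi_1)=0 .$$ Write $U(y)$, $V(y)$ for the left-hand sides of the two boundary conditions, and let $C(\cdot,\lambda)$, $S(\cdot,\lambda)$ be the solutions of the equation with $C(0)=1$, $C'(0)=0$, $S(0)=0$, $S'(0)=1$. The eigenvalues are the zeros of the entire function $\Delta(\lambda)=U(C)V(S)-U(S)V(C)$; they can be listed as a sequence $\lambda_0,\lambda_1,\dots$ in order of nondecreasing modulus, each repeated according to its multiplicity as a zero of $\Delta$. Fix such a sequence. Denote by $x_n^0<x_n^1<\cdots$ the zeros in $(0,1)$ of an eigenfunction for $\lambda_n$ (the nodal points, labelled by $n$ and $j$), and let $X$ be the set of all labelled nodal points. Put $M=2r_0r_1$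 and call a set $X_0\subseteq X$ of labelled nodal points dense if every $x\in[0,1]$ is the limit of a sequence of points $x_m^j\in X_0$ whose indices $m$ are multiples of $M$ and tend to infinity. Then $X$ itself is dense in this sense, and for every dense $X_0\subseteq X$ the following holds. For every $x\in[0,1]$ the limit $$f(x)=\lim m^2\pi^2\left(x_m^j-\frac{j+\frac12}{m}\right)$$ exists, and has the same value, along all sequences of points $x_m^j\in X_0$ that converge to $x$ and for which $m=Mn=2r_0r_1n\to\infty$. The function $f$ is differentiable on $[0,1]$, and $$q(x)=2\bigl(f'(x)+f(0)-f(1)\bigr)\ \ (x\in[0,1]),\qquad \gamma_0-h=f(0),\qquad \gamma_1-H=f(1).$$ In particular, if $(h,H)$ is known, then $(\gamma_0,\gamma_1)=(h+f(0),H+f(1))$, and if $(\gamma_0,\gamma_1)$ is known, then $(h,H)=(\gamma_0-f(0),\gamma_1-f(1))$. -/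

import Mathlib

open Set Filter Topology

noncomputable section

/-- The data of the nonlocal Sturm-Liouville problem
`-y'' + q y = μ y` on `(0,1)`, `y'(0) + h y(0) = γ₀ y(ξ₀)`, `y'(1) + H y(1) = γ₁ y(ξ₁)`
with real `h` and `H`. -/
structure NonlocalSL where
  q : ℝ → ℝ
  h : ℝ
  H : ℝ
  γ₀ : ℝ
  γ₁ : ℝ
  ξ₀ : ℝ
  ξ₁ : ℝ

namespace NonlocalSL

/-- The derivative on `[0,1]`, one-sided at the endpoints. -/
def D (y : ℝ → ℂ) (x : ℝ) : ℂ := derivWithin y (Icc 0 1) x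

/-- `y` is twice differentiable on `[0,1]` and solves `-y'' + q y = μ y` there,
with complex spectral parameter `μ`. -/
def IsSolution (L : NonlocalSL) (μ : ℂ) (y : ℝ → ℂ) : Prop :=
  DifferentiableOn ℝ y (Icc 0 1) ∧
    ∀ x ∈ Icc (0 : ℝ) 1, DifferentiableWithinAt ℝ (D y) (Icc 0 1) x ∧
      -D (D y) x + (L.q x : ℂ) * y x = μ * y x

/-- The boundary form at the left endpoint. -/
def U (L : NonlocalSL) (y : ℝ → ℂ) : ℂ := D y 0 + L.h * y 0 - L.γ₀ * y L.ξ₀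

/-- The boundary form at the right endpoint. -/
def V (L : NonlocalSL) (y : ℝ → ℂ) : ℂ := D y 1 + L.H * y 1 - L.γ₁ * y L.ξ₁

/-- The solution with `S(0) = 0`, `S'(0) = 1` (on `[0,1]` it is unique; other values are
never used). -/
def S (L : NonlocalSL) (μ : ℂ) : ℝ → ℂ :=
  Classical.epsilon fun y => L.IsSolution μ y ∧ y 0 = 0 ∧ D y 0 = 1

/-- The solution with `C(0) = 1`, `C'(0) = 0` (on `[0,1]` it is unique; other values are
never used). -/
def C (L : NonlocalSL) (μ : ℂ) : ℝ → ℂ :=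
  Classical.epsilon fun y => L.IsSolution μ y ∧ y 0 = 1 ∧ D y 0 = 0

/-- The characteristic function, whose zeros are the eigenvalues. -/
def charFun (L : NonlocalSL) (μ : ℂ) : ℂ :=
  Matrix.det !![L.U (L.C μ), L.U (L.S μ); L.V (L.C μ), L.V (L.S μ)]

/-- `lam 0, lam 1, …` lists all eigenvalues, each as often as its multiplicity as a zero of
the characteristic function, in order of nondecreasing modulus. -/
structure IsEigenvalueSequence (L : NonlocalSL) (lam : ℕ → ℂ) : Prop where
  mono : Monotone fun n => ‖lam n‖
  mult : ∀ μ : ℂ, {n : ℕ | lam n = μ}.encard = analyticOrderAt L.charFun μ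

/-- `y` is an eigenfunction for `μ`: a nontrivial solution satisfying both boundary conditions. -/
structure IsEigenfunction (L : NonlocalSL) (μ : ℂ) (y : ℝ → ℂ) : Prop where
  sol : L.IsSolution μ y
  left : L.U y = 0
  right : L.V y = 0
  nontrivial : ∃ x ∈ Icc (0 : ℝ) 1, y x ≠ 0

/-- The set of labelled nodal points: `(n, j, t)` belongs to it when `t ∈ (0,1)` is a zero of an
eigenfunction for the `n`-th eigenvalue that has exactly `j` zeros in `(0,t)`. In other words,
`t = x_n^j` with the zeros in `(0,1)` numbered `x_n^0 < x_n^1 < …`. -/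
def nodalPoints (L : NonlocalSL) (lam : ℕ → ℂ) : Set (ℕ × ℕ × ℝ) :=
  {P | ∃ y : ℝ → ℂ, L.IsEigenfunction (lam P.1) y ∧ P.2.2 ∈ Ioo (0 : ℝ) 1 ∧ y P.2.2 = 0 ∧
    {s : ℝ | s ∈ Ioo (0 : ℝ) P.2.2 ∧ y s = 0}.encard = P.2.1}

end NonlocalSL

/-- The points `t i = x_m^j` with `m = M * n i`, `j = j i` all belong to the labelled set `X₀`,
their index `m` tends to infinity, and they converge to `x`. -/
structure NodalApprox (X₀ : Set (ℕ × ℕ × ℝ)) (M : ℕ) (x : ℝ) (n j : ℕ → ℕ) (t : ℕ → ℝ) :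
    Prop where
  mem : ∀ i, (M * n i, j i, t i) ∈ X₀
  index : Tendsto n atTop atTop
  lim : Tendsto t atTop (𝓝 x)

/-- Every point of `[0,1]` is the limit of points `x_m^j` of `X₀`, `m ∈ M ℕ`, `m → ∞`. -/
def NodalDense (X₀ : Set (ℕ × ℕ × ℝ)) (M : ℕ) : Prop :=
  ∀ x ∈ Icc (0 : ℝ) 1, ∃ (n j : ℕ → ℕ) (t : ℕ → ℝ), NodalApprox X₀ M x n j t

/-- `f(x) = lim m² π² (x_m^j - (j + 1/2) / m)` for all `x ∈ [0,1]` and along all sequences of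
points `x_m^j` of `X₀` that converge to `x`, with `m ∈ M ℕ` and `m → ∞`. -/
def IsNodalLimit (X₀ : Set (ℕ × ℕ × ℝ)) (M : ℕ) (f : ℝ → ℝ) : Prop :=
  ∀ x ∈ Icc (0 : ℝ) 1, ∀ (n j : ℕ → ℕ) (t : ℕ → ℝ), NodalApprox X₀ M x n j t →
    Tendsto (fun i => ((M * n i : ℕ) : ℝ) ^ 2 * Real.pi ^ 2 *
      (t i - ((j i : ℝ) + 1 / 2) / ((M * n i : ℕ) : ℝ))) atTop (𝓝 (f x))

end

/-! Write an eigenvalue as `ρ ^ 2`. A solution with real values has a phase `θ` with `y = R cos θ`,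
`y' = -ρ R sin θ`, and `θ' = ρ - (q / ρ) cos² θ`. Since `cos² θ = (1 + cos 2θ) / 2`, and the
oscillating half can be integrated by parts when `q` is `C¹`, one gets `θ(x) = θ(0) + ρ x - Q(x) /
(2ρ) + O(ρ⁻²)` with `Q` the primitive of `q` vanishing at `0` (`exists_prufer_expansion`). For large
`ρ` the phase is increasing and starts within `π / 2` of `0`, so the node labelled `j` is exactly
the point where `θ = (j + 1/2) π`.

The role of `M = 2 r₀ r₁` is arithmetic: for `m = M n` the numbers `m`, `m ξ₀`, `m ξ₁` are even
integers. As `ρ` is close to `m π`, an eigenfunction with `y(0) = 1` satisfies `y(ξ₀), y(ξ₁), y(1) →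
1` (`tendsto_solution`), and the nonlocal conditions act asymptotically as local ones with
coefficients `h - γ₀` and `H - γ₁`. Hence `ρ θ(0) → h - γ₀` and `ρ (θ(1) - m π) → H - γ₁`. The
expansion at `x = 1`, where `Q` vanishes by the mean condition, gives `ρ (ρ - m π) → ω := H - h + γ₀
- γ₁` (`exists_prufer`). Solving `θ(x) = (j + 1/2) π` for `x` yields the nodal limit `f(x) = Q(x) /
2 + (γ₀ - h) - ω x`. Therefore `f(0) = γ₀ - h`, `f(1) = γ₁ - H`, `f(0) - f(1) = ω` and `f' = q / 2 -
ω`, which is the reconstruction.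

The index of an eigenvalue is its place in a list by modulus, so `ρ ≈ m π` must be proved with the
correct numbering. The characteristic function equals `ρ sin ρ` up to `O(exp |Im ρ|)`, and Rouché's
theorem on the circles `|μ| = ((N + 1/2) π)²` gives exactly `N + 1` eigenvalues inside. So `λ_N` is
alone between two consecutive circles. Conjugation symmetry makes it real, and `ρ |sin ρ| ≤ K` then
localizes its root (`exists_sqrt`). All this rests on the characteristic function being entire,
obtained by inverting a Volterra operator that depends analytically on `μ`. -/

noncomputable section

/-! ### Counting zeros of entire functions -/

/-- The number of zeros of `f` in the open disc of radius `R` about `0`, with multiplicity. -/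
def zeroCount (f : ℂ → ℂ) (R : ℝ) : ℕ :=
  ∑ᶠ z ∈ Metric.ball (0 : ℂ) R, analyticOrderNatAt f z

lemma finite_zeros_closedBall {f : ℂ → ℂ} (hf : Differentiable ℂ f) {w : ℂ} (hw : f w ≠ 0)
    (R : ℝ) : (Metric.closedBall (0 : ℂ) R ∩ {z | f z = 0}).Finite := by
  by_contra hinf
  obtain ⟨a, -, ha⟩ := Set.Infinite.exists_accPt_of_subset_isCompact hinf
    (isCompact_closedBall (0 : ℂ) R) inter_subset_left
  have hfr : ∃ᶠ z in 𝓝[≠] a, f z = 0 := by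
    rw [accPt_iff_frequently_nhdsNE] at ha
    exact ha.mono fun z hz => hz.2
  have h0 : f = fun _ => 0 := AnalyticOnNhd.eq_of_frequently_eq (𝕜 := ℂ)
    (fun z _ => hf.analyticAt z) (fun z _ => analyticAt_const) hfr
  exact hw (by rw [h0])

lemma analyticOrderAt_ne_top_of_entire {f : ℂ → ℂ} (hf : Differentiable ℂ f) {w : ℂ}
    (hw : f w ≠ 0) (z : ℂ) : analyticOrderAt f z ≠ ⊤ := by
  intro h
  rw [analyticOrderAt_eq_top] at h
  have h0 : f = fun _ => 0 := AnalyticOnNhd.eq_of_eventuallyEq (𝕜 := ℂ) (z₀ := z)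
    (fun z _ => hf.analyticAt z) (fun z _ => analyticAt_const) h
  exact hw (by rw [h0])

lemma analyticOrderNatAt_eq_zero_iff {f : ℂ → ℂ} (hf : Differentiable ℂ f) {w : ℂ}
    (hw : f w ≠ 0) (z : ℂ) : analyticOrderNatAt f z = 0 ↔ f z ≠ 0 := by
  have h := Nat.cast_analyticOrderNatAt (analyticOrderAt_ne_top_of_entire hf hw z)
  rw [← (hf.analyticAt z).analyticOrderAt_eq_zero, ← h, Nat.cast_eq_zero]

lemma finite_support_order {f : ℂ → ℂ} (hf : Differentiable ℂ f) {w : ℂ}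
    (hw : f w ≠ 0) (R : ℝ) :
    (Metric.ball (0 : ℂ) R ∩ Function.support (analyticOrderNatAt f)).Finite := by
  refine (finite_zeros_closedBall hf hw R).subset fun z hz => ⟨Metric.ball_subset_closedBall hz.1, ?_⟩
  by_contra h
  exact hz.2 ((analyticOrderNatAt_eq_zero_iff hf hw z).2 h)

/-- Orders add under multiplication. This drives the induction in the argument principle, where
zeros are divided out one at a time. -/
lemma zeroCount_mul_linear {g : ℂ → ℂ} (hg : Differentiable ℂ g) {w : ℂ} (hw : g w ≠ 0)
    {R : ℝ} {a : ℂ} (ha : a ∈ Metric.ball (0 : ℂ) R) :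
    zeroCount (fun z => (z - a) * g z) R = zeroCount g R + 1 := by
  have hlin : Differentiable ℂ fun z : ℂ => z - a := by fun_prop
  have hlw : (fun z : ℂ => z - a) (a + 1) ≠ 0 := by simp
  have hord (z : ℂ) : analyticOrderNatAt (fun z => (z - a) * g z) z =
      analyticOrderNatAt (fun z => z - a) z + analyticOrderNatAt g z :=
    analyticOrderNatAt_mul (hlin.analyticAt z) (hg.analyticAt z)
      (analyticOrderAt_ne_top_of_entire hlin hlw z) (analyticOrderAt_ne_top_of_entire hg hw z)
  unfold zeroCount
  simp_rw [hord]
  rw [finsum_mem_add_distrib' (finite_support_order hlin hlw R) (finite_support_order hg hw R),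
    add_comm]
  congr 1
  have hone : analyticOrderNatAt (fun z : ℂ => z - a) a = 1 := by
    have : analyticOrderAt (fun z : ℂ => z - a) a = 1 := by
      refine AnalyticAt.analyticOrderAt_eq_one_of_zero_deriv_ne_zero (hlin.analyticAt a) (by simp) ?_
      simp
    simp [analyticOrderNatAt, this]
  rw [← hone]
  rw [finsum_eq_single _ a]
  · simp only [ha, finsum_true]
  · intro z hne
    rw [(analyticOrderNatAt_eq_zero_iff hlin hlw z).2 (sub_ne_zero.2 hne)]
    exact finsum_zero

lemma circleIntegrable_logDeriv {f : ℂ → ℂ} (hf : Differentiable ℂ f) {R : ℝ} (hR : 0 ≤ R)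
    (h0 : ∀ z ∈ Metric.sphere (0 : ℂ) R, f z ≠ 0) : CircleIntegrable (logDeriv f) 0 R := by
  refine ContinuousOn.circleIntegrable hR ?_
  have : ContinuousOn (fun z => deriv f z / f z) (Metric.sphere (0 : ℂ) R) :=
    ContinuousOn.div (hf.contDiff (n := 1)).continuous_deriv_one.continuousOn
      hf.continuous.continuousOn h0
  exact this

/-- The argument principle for entire functions on a disc. -/
theorem circleIntegral_logDeriv_eq_zeroCount {R : ℝ} (hR : 0 < R) (n : ℕ) :
    ∀ f : ℂ → ℂ, Differentiable ℂ f → (∀ z ∈ Metric.sphere (0 : ℂ) R, f z ≠ 0) →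
      zeroCount f R = n → (∮ z in C(0, R), logDeriv f z) = n * (2 * Real.pi * Complex.I) := by
  obtain ⟨w, hw⟩ : (Metric.sphere (0 : ℂ) R).Nonempty := NormedSpace.sphere_nonempty.2 hR.le
  induction n with
  | zero =>
    intro f hf h0 hn
    have hfw := h0 w hw
    have hz : ∀ z ∈ Metric.closedBall (0 : ℂ) R, f z ≠ 0 := by
      intro z hz hfz
      have hzb : z ∈ Metric.ball (0 : ℂ) R := by
        rcases (Metric.mem_closedBall.1 hz).lt_or_eq with h | h
        · exact h
        · exact absurd hfz (h0 z h)
      have h1 : ∀ y ∈ Metric.ball (0 : ℂ) R ∩ Function.support (analyticOrderNatAt f), False := by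
        unfold zeroCount at hn
        rw [← finsum_mem_inter_support, finsum_mem_eq_finite_toFinset_sum _ (finite_support_order hf hfw R)] at hn
        intro y hy
        have := (Finset.sum_eq_zero_iff.1 hn) y (by simpa using hy)
        exact hy.2 this
      refine h1 z ⟨hzb, fun h => ?_⟩
      exact (analyticOrderNatAt_eq_zero_iff hf hfw z).1 h hfz
    rw [Nat.cast_zero, zero_mul]
    refine Complex.circleIntegral_eq_zero_of_differentiable_on_off_countable hR.le
      countable_empty ?_ ?_
    · exact ContinuousOn.div (hf.contDiff (n := 1)).continuous_deriv_one.continuousOn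
        hf.continuous.continuousOn hz
    · intro z hzz
      refine DifferentiableAt.div ?_ (hf z) (hz z (Metric.ball_subset_closedBall hzz.1))
      exact (hf.analyticAt z).deriv.differentiableAt
  | succ n ih =>
    intro f hf h0 hn
    have hfw := h0 w hw
    obtain ⟨a, ha, hfa⟩ : ∃ a ∈ Metric.ball (0 : ℂ) R, f a = 0 := by
      by_contra hcon
      push Not at hcon
      have : zeroCount f R = 0 := by
        unfold zeroCount
        refine finsum_mem_eq_zero_of_forall_eq_zero fun z hz => ?_
        exact (analyticOrderNatAt_eq_zero_iff hf hfw z).2 (hcon z hz)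
      omega
    -- Since `f a = 0`, the divided difference at `a` is the entire quotient `f z / (z - a)`.
    set g := dslope f a with hgdef
    have hg : Differentiable ℂ g := by
      rw [← differentiableOn_univ] at hf ⊢
      exact (Complex.differentiableOn_dslope univ_mem).2 hf
    have hfg : f = fun z => (z - a) * g z := by
      funext z
      have := sub_smul_dslope f a z
      rw [hfa, sub_zero, smul_eq_mul] at this
      exact this.symm
    have hg0 : ∀ z ∈ Metric.sphere (0 : ℂ) R, g z ≠ 0 := by
      intro z hz hgz
      exact h0 z hz (by rw [hfg]; simp [hgz])
    have hcount : zeroCount g R = n := by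
      have := zeroCount_mul_linear hg (hg0 w hw) ha
      rw [← hfg, hn] at this
      omega
    have hne : ∀ z ∈ Metric.sphere (0 : ℂ) R, z - a ≠ 0 := by
      intro z hz hza
      rw [sub_eq_zero.1 hza] at hz
      rw [Metric.mem_ball] at ha
      rw [Metric.mem_sphere] at hz
      exact ha.ne hz
    have hcongr : EqOn (logDeriv f) (fun z => (z - a)⁻¹ + logDeriv g z) (Metric.sphere (0 : ℂ) R) := by
      intro z hz
      rw [hfg, logDeriv_mul z (hne z hz) (hg0 z hz) (by fun_prop) (hg z)]
      congr 1
      simp [logDeriv_apply]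
    rw [circleIntegral.integral_congr hR.le hcongr, circleIntegral.integral_add _
      (circleIntegrable_logDeriv hg hR.le hg0), ih g hg hg0 hcount,
      circleIntegral.integral_sub_inv_of_mem_ball ha]
    · push_cast; ring
    · refine ContinuousOn.circleIntegrable hR.le ?_
      exact ContinuousOn.inv₀ (by fun_prop) hne

/-- Rouché's theorem for entire functions on a disc. -/
theorem zeroCount_eq_of_norm_sub_lt {f g : ℂ → ℂ} (hf : Differentiable ℂ f)
    (hg : Differentiable ℂ g) {R : ℝ} (hR : 0 < R)
    (h : ∀ z ∈ Metric.sphere (0 : ℂ) R, ‖f z - g z‖ < ‖g z‖) : zeroCount f R = zeroCount g R := by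
  have hg0 : ∀ z ∈ Metric.sphere (0 : ℂ) R, g z ≠ 0 := fun z hz h0 => by
    have := h z hz
    rw [h0, norm_zero] at this
    exact (norm_nonneg _).not_gt this
  have hf0 : ∀ z ∈ Metric.sphere (0 : ℂ) R, f z ≠ 0 := fun z hz h0 => by
    have := h z hz
    rw [h0, zero_sub, norm_neg] at this
    exact this.false
  have hzero : (∮ z in C(0, R), (logDeriv f z - logDeriv g z)) = 0 := by
    -- On the circle `f / g` stays within distance `1` of `1`, where the principal logarithm is
    -- holomorphic, so the difference of logarithmic derivatives has a primitive along it.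
    refine circleIntegral.integral_eq_zero_of_hasDerivWithinAt (f := fun z => Complex.log (f z / g z))
      hR.le fun z hz => ?_
    have hslit : f z / g z ∈ Complex.slitPlane := by
      rw [← add_sub_cancel 1 (f z / g z)]
      apply Complex.mem_slitPlane_of_norm_lt_one
      rw [div_sub_one (hg0 z hz), norm_div, div_lt_one (norm_pos_iff.2 (hg0 z hz))]
      exact h z hz
    have hd := ((hf z).hasDerivAt.div (hg z).hasDerivAt (hg0 z hz)).clog hslit
    refine (hd.congr_deriv ?_).hasDerivWithinAt
    have := hg0 z hz
    have := hf0 z hz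
    simp only [logDeriv_apply, Pi.div_apply]
    field_simp
  rw [circleIntegral.integral_sub (circleIntegrable_logDeriv hf hR.le hf0)
    (circleIntegrable_logDeriv hg hR.le hg0),
    circleIntegral_logDeriv_eq_zeroCount hR _ f hf hf0 rfl,
    circleIntegral_logDeriv_eq_zeroCount hR _ g hg hg0 rfl, ← sub_mul] at hzero
  have hne : (2 * Real.pi * Complex.I : ℂ) ≠ 0 := Complex.two_pi_I_ne_zero
  have := (mul_eq_zero.1 hzero).resolve_right hne
  exact_mod_cast sub_eq_zero.1 this

/-! ### Listing the zeros of an entire function -/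

lemma encard_norm_lt_eq_zeroCount {ι : Type*} {f : ℂ → ℂ} (hf : Differentiable ℂ f) {w : ℂ}
    (hw : f w ≠ 0) {l : ι → ℂ} (hl : ∀ z, {i | l i = z}.encard = analyticOrderAt f z) (R : ℝ) :
    {i | ‖l i‖ < R}.encard = zeroCount f R := by
  have hfin := finite_support_order hf hw R
  have hord (z : ℂ) : {i | l i = z}.encard = (analyticOrderNatAt f z : ℕ∞) := by
    rw [hl, Nat.cast_analyticOrderNatAt (analyticOrderAt_ne_top_of_entire hf hw z)]
  have hset : {i | ‖l i‖ < R} =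
      ⋃ z ∈ Metric.ball (0 : ℂ) R ∩ Function.support (analyticOrderNatAt f), {i | l i = z} := by
    ext i
    simp only [mem_ofPred_eq, mem_iUnion, exists_prop, mem_inter_iff, Metric.mem_ball,
      dist_zero_right, Function.mem_support, exists_eq_right']
    refine ⟨fun h => ⟨h, fun h0 => ?_⟩, fun h => h.1⟩
    have := hord (l i)
    rw [h0, Nat.cast_zero, encard_eq_zero] at this
    exact (this ▸ (rfl : l i = l i) : i ∈ (∅ : Set ι))
  rw [hset, hfin.encard_biUnion]
  · have hz : zeroCount f R = ∑ z ∈ hfin.toFinset, analyticOrderNatAt f z := by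
      unfold zeroCount
      rw [← finsum_mem_inter_support, finsum_mem_eq_finite_toFinset_sum _ hfin]
    rw [hz, finsum_mem_eq_finite_toFinset_sum _ hfin]
    push_cast
    exact Finset.sum_congr rfl fun z _ => hord z
  · intro z _ z' _ hne
    exact Set.disjoint_left.2 fun i hi hi' => hne (hi.symm.trans hi')

/-- Break ties in `w` by an injection into `ℕ`. In the resulting linear order every element has
finitely many predecessors, and counting them is an order embedding into `ℕ` with infinite range. -/
lemma exists_monotone_equiv_nat {Z : Type*} [Infinite Z] (w : Z → ℝ)
    (hfin : ∀ r, {z | w z ≤ r}.Finite) : ∃ e : ℕ ≃ Z, Monotone fun n => w (e n) := by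
  classical
  have hc : Countable Z := by
    rw [← countable_univ_iff]
    have : (univ : Set Z) = ⋃ n : ℕ, {z | w z ≤ n} := by
      ext z
      simp only [mem_univ, mem_iUnion, mem_ofPred_eq, true_iff]
      exact exists_nat_ge (w z)
    rw [this]
    exact countable_iUnion fun n => (hfin n).countable
  obtain ⟨c, hcinj⟩ := hc.exists_injective_nat
  let key : Z → ℝ ×ₗ ℕ := fun z => toLex (w z, c z)
  have hkey : Function.Injective key := fun a b h => hcinj (Prod.ext_iff.1 (toLex.injective h)).2
  have hkw {a b : Z} (h : key a ≤ key b) : w a ≤ w b := by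
    rcases Prod.Lex.toLex_le_toLex.1 h with h | h
    · exact h.le
    · exact h.1.le
  have hbelow (z : Z) : {a | key a < key z}.Finite :=
    (hfin (w z)).subset fun a ha => hkw (le_of_lt ha)
  let rank : Z → ℕ := fun z => {a | key a < key z}.ncard
  have hrank {a b : Z} (h : key a < key b) : rank a < rank b := by
    refine ncard_lt_ncard ?_ (hbelow b)
    refine ⟨fun x hx => lt_trans hx h, fun hsub => ?_⟩
    exact lt_irrefl (key a) (hsub (show a ∈ {x | key x < key b} from h))
  have hinj : Function.Injective rank := by
    intro a b hab
    rcases lt_trichotomy (key a) (key b) with h | h | h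
    · exact absurd hab (hrank h).ne
    · exact hkey h
    · exact absurd hab (hrank h).ne'
  have : Infinite (range rank) := (infinite_range_of_injective hinj).to_subtype
  refine ⟨(Nat.Subtype.orderIsoOfNat (range rank)).toEquiv.trans
    (Equiv.ofInjective rank hinj).symm, fun n m hnm => ?_⟩
  set e := (Nat.Subtype.orderIsoOfNat (range rank)).toEquiv.trans (Equiv.ofInjective rank hinj).symm
  have he (k : ℕ) : rank (e k) = (Nat.Subtype.orderIsoOfNat (range rank) k : ℕ) :=
    congrArg Subtype.val
      ((Equiv.ofInjective rank hinj).apply_symm_apply (Nat.Subtype.orderIsoOfNat (range rank) k))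
  have hle : rank (e n) ≤ rank (e m) := by
    rw [he, he]
    exact (Nat.Subtype.orderIsoOfNat (range rank)).monotone hnm
  refine hkw (not_lt.1 fun hlt => ?_)
  exact absurd (hrank hlt) (not_lt.2 hle)

/-- The zeros of an entire function with infinitely many zeros can be listed by modulus. -/
theorem exists_zero_sequence {f : ℂ → ℂ} (hf : Differentiable ℂ f) {w : ℂ} (hw : f w ≠ 0)
    (hinf : ∀ N : ℕ, ∃ R, N ≤ zeroCount f R) :
    ∃ l : ℕ → ℂ, (Monotone fun n => ‖l n‖) ∧
      ∀ z, {n | l n = z}.encard = analyticOrderAt f z := by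
  -- One index for each zero and each unit of its multiplicity.
  let Z := Σ z : ℂ, Fin (analyticOrderNatAt f z)
  have hZ (z : ℂ) : {a : Z | a.1 = z}.encard = analyticOrderAt f z := by
    rw [← Nat.cast_analyticOrderNatAt (analyticOrderAt_ne_top_of_entire hf hw z)]
    have : {a : Z | a.1 = z} = (fun i => (⟨z, i⟩ : Z)) '' univ := by
      ext ⟨a, i⟩
      simp only [mem_ofPred_eq, image_univ, mem_range]
      constructor
      · rintro rfl
        exact ⟨i, rfl⟩
      · rintro ⟨j, hj⟩
        exact (congrArg Sigma.fst hj).symm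
    have hinj : Function.Injective fun i => (⟨z, i⟩ : Z) :=
      fun i j h => eq_of_heq (Sigma.mk.inj h).2
    rw [this, hinj.encard_image, encard_univ]
    simp
  have hcount := encard_norm_lt_eq_zeroCount hf hw (l := fun a : Z => a.1) hZ
  have hinfZ : Infinite Z := by
    by_contra hfinZ
    rw [not_infinite_iff_finite] at hfinZ
    obtain ⟨R, hR⟩ := hinf (Nat.card Z + 1)
    have h1 : {a : Z | ‖a.1‖ < R}.ncard ≤ Nat.card Z := by
      rw [← ncard_univ]
      exact ncard_le_ncard (subset_univ _) finite_univ
    have h2 : {a : Z | ‖a.1‖ < R}.ncard = zeroCount f R := by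
      rw [ncard, hcount R]; rfl
    omega
  obtain ⟨e, he⟩ := exists_monotone_equiv_nat (fun a : Z => ‖a.1‖) fun r => by
    refine Set.Finite.subset ?_ (fun a (ha : ‖a.1‖ ≤ r) => (lt_add_one r).trans_le' ha :
      {a : Z | ‖a.1‖ ≤ r} ⊆ {a : Z | ‖a.1‖ < r + 1})
    exact finite_of_encard_eq_coe (hcount (r + 1))
  refine ⟨fun n => (e n).1, he, fun z => ?_⟩
  rw [← hZ z, ← (e.injective).encard_image]
  congr 1
  ext a
  simp only [mem_image, mem_ofPred_eq]
  refine ⟨?_, fun h => ⟨e.symm a, by simpa using h, by simp⟩⟩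
  rintro ⟨n, hn, rfl⟩
  exact hn

/-! ### Growth of solutions -/

/-- Grönwall in both directions: `u exp(-K t)` decreases and `u exp(K t)` increases. Both are needed
because the base point may be the interior point `ξ₀`. -/
lemma le_mul_exp_of_abs_deriv_le {u u' : ℝ → ℝ} {K : ℝ}
    (hu : ∀ x ∈ Icc (0 : ℝ) 1, HasDerivWithinAt u (u' x) (Icc 0 1) x)
    (hK : ∀ x ∈ Icc (0 : ℝ) 1, |u' x| ≤ K * u x) {x x₀ : ℝ} (hx : x ∈ Icc (0 : ℝ) 1)
    (hx₀ : x₀ ∈ Icc (0 : ℝ) 1) : u x ≤ u x₀ * Real.exp (K * |x - x₀|) := by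
  have key (c : ℝ) : ∀ x ∈ Icc (0 : ℝ) 1, HasDerivWithinAt (fun t => u t * Real.exp (c * t))
      ((u' x + c * u x) * Real.exp (c * x)) (Icc 0 1) x := by
    intro x hx
    have h1 : HasDerivAt (fun t : ℝ => Real.exp (c * t)) (Real.exp (c * x) * c) x := by
      simpa using ((hasDerivAt_id x).const_mul c).exp
    exact ((hu x hx).mul h1.hasDerivWithinAt).congr_deriv (by ring)
  have hint : ∀ (g g' : ℝ → ℝ), (∀ x ∈ Icc (0 : ℝ) 1, HasDerivWithinAt g (g' x) (Icc 0 1) x) →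
      ∀ x ∈ interior (Icc (0 : ℝ) 1), HasDerivWithinAt g (g' x) (interior (Icc (0 : ℝ) 1)) x :=
    fun g g' h x hx => (h x (interior_subset hx)).mono interior_subset
  rcases le_total x₀ x with h | h
  · have hanti : AntitoneOn (fun t => u t * Real.exp (-K * t)) (Icc (0 : ℝ) 1) := by
      refine antitoneOn_of_hasDerivWithinAt_nonpos (convex_Icc 0 1)
        (fun x hx => (key (-K) x hx).continuousWithinAt) (hint _ _ (key (-K))) fun x hx => ?_
      have := (abs_le.1 (hK x (interior_subset hx))).2
      exact mul_nonpos_of_nonpos_of_nonneg (by linarith) (Real.exp_pos _).le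
    have := hanti hx₀ hx h
    simp only at this
    rw [abs_of_nonneg (sub_nonneg.2 h)]
    calc u x = u x * Real.exp (-K * x) * Real.exp (K * x) := by
          rw [mul_assoc, ← Real.exp_add]; simp
      _ ≤ u x₀ * Real.exp (-K * x₀) * Real.exp (K * x) := by gcongr
      _ = _ := by rw [mul_assoc, ← Real.exp_add]; ring_nf
  · have hmono : MonotoneOn (fun t => u t * Real.exp (K * t)) (Icc (0 : ℝ) 1) := by
      refine monotoneOn_of_hasDerivWithinAt_nonneg (convex_Icc 0 1)
        (fun x hx => (key K x hx).continuousWithinAt) (hint _ _ (key K)) fun x hx => ?_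
      have := (abs_le.1 (hK x (interior_subset hx))).1
      exact mul_nonneg (by linarith) (Real.exp_pos _).le
    have := hmono hx hx₀ h
    simp only at this
    rw [abs_of_nonpos (sub_nonpos.2 h)]
    calc u x = u x * Real.exp (K * x) * Real.exp (-K * x) := by
          rw [mul_assoc, ← Real.exp_add]; simp
      _ ≤ u x₀ * Real.exp (K * x₀) * Real.exp (-K * x) := by gcongr
      _ = _ := by rw [mul_assoc, ← Real.exp_add]; ring_nf

namespace NonlocalSL

lemma uniqueDiffWithinAt_Icc {x : ℝ} (hx : x ∈ Icc (0 : ℝ) 1) :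
    UniqueDiffWithinAt ℝ (Icc (0 : ℝ) 1) x := uniqueDiffOn_Icc_zero_one x hx

lemma D_eq {y : ℝ → ℂ} {p : ℂ} {x : ℝ} (hx : x ∈ Icc (0 : ℝ) 1)
    (h : HasDerivWithinAt y p (Icc 0 1) x) : D y x = p :=
  h.derivWithin (uniqueDiffWithinAt_Icc hx)

variable {L : NonlocalSL} {μ : ℂ} {y z : ℝ → ℂ}

lemma IsSolution.hasDeriv (h : L.IsSolution μ y) {x : ℝ} (hx : x ∈ Icc (0 : ℝ) 1) :
    HasDerivWithinAt y (D y x) (Icc 0 1) x := (h.1 x hx).hasDerivWithinAt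

lemma IsSolution.hasDeriv_D (h : L.IsSolution μ y) {x : ℝ} (hx : x ∈ Icc (0 : ℝ) 1) :
    HasDerivWithinAt (D y) ((L.q x - μ) * y x) (Icc 0 1) x := by
  refine ((h.2 x hx).1.hasDerivWithinAt).congr_deriv ?_
  have := (h.2 x hx).2
  change -derivWithin (D y) (Icc 0 1) x + _ = _ at this
  linear_combination -this

lemma isSolution_of_hasDeriv {p : ℝ → ℂ}
    (hy : ∀ x ∈ Icc (0 : ℝ) 1, HasDerivWithinAt y (p x) (Icc 0 1) x)
    (hp : ∀ x ∈ Icc (0 : ℝ) 1, HasDerivWithinAt p ((L.q x - μ) * y x) (Icc 0 1) x) :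
    L.IsSolution μ y := by
  have hD : ∀ x ∈ Icc (0 : ℝ) 1, D y x = p x := fun x hx => D_eq hx (hy x hx)
  refine ⟨fun x hx => (hy x hx).differentiableWithinAt, fun x hx => ?_⟩
  have h2 := (hp x hx).congr hD (hD x hx)
  refine ⟨h2.differentiableWithinAt, ?_⟩
  rw [D_eq hx h2]
  ring

lemma D_add_mul (hy : L.IsSolution μ y) (hz : L.IsSolution μ z) (a b : ℂ) {x : ℝ}
    (hx : x ∈ Icc (0 : ℝ) 1) :
    D (fun t => a * y t + b * z t) x = a * D y x + b * D z x :=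
  D_eq hx (((hy.hasDeriv hx).const_mul a).add ((hz.hasDeriv hx).const_mul b))

lemma IsSolution.add_mul (hy : L.IsSolution μ y) (hz : L.IsSolution μ z) (a b : ℂ) :
    L.IsSolution μ fun t => a * y t + b * z t := by
  refine isSolution_of_hasDeriv (p := fun t => a * D y t + b * D z t) (fun x hx =>
    ((hy.hasDeriv hx).const_mul a).add ((hz.hasDeriv hx).const_mul b)) fun x hx => ?_
  exact (((hy.hasDeriv_D hx).const_mul a).add ((hz.hasDeriv_D hx).const_mul b)).congr_deriv
    (by ring)

/-- The energy estimate: a weighted energy of a solution grows at most exponentially. -/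
lemma IsSolution.energy_le (h : L.IsSolution μ y) {w K : ℝ} (hw : 0 < w)
    (hK : ∀ x ∈ Icc (0 : ℝ) 1, ‖(w ^ 2 : ℝ) + (L.q x : ℂ) - μ‖ ≤ K * w) {x x₀ : ℝ}
    (hx : x ∈ Icc (0 : ℝ) 1) (hx₀ : x₀ ∈ Icc (0 : ℝ) 1) :
    (w * ‖y x‖) ^ 2 + ‖D y x‖ ^ 2 ≤
      ((w * ‖y x₀‖) ^ 2 + ‖D y x₀‖ ^ 2) * Real.exp (K * |x - x₀|) := by
  have hd : ∀ x ∈ Icc (0 : ℝ) 1, HasDerivWithinAt (fun t => w ^ 2 * ‖y t‖ ^ 2 + ‖D y t‖ ^ 2)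
      (w ^ 2 * (2 * inner ℝ (y x) (D y x)) + 2 * inner ℝ (D y x) ((L.q x - μ) * y x))
      (Icc 0 1) x := fun x hx =>
    ((h.hasDeriv hx).norm_sq.const_mul _).add (h.hasDeriv_D hx).norm_sq
  have hb : ∀ x ∈ Icc (0 : ℝ) 1,
      |w ^ 2 * (2 * inner ℝ (y x) (D y x)) + 2 * inner ℝ (D y x) ((L.q x - μ) * y x)| ≤
        K * (w ^ 2 * ‖y x‖ ^ 2 + ‖D y x‖ ^ 2) := by
    intro x hx
    -- The two inner products combine, so only the mismatch `w² + q - μ` between the weight and the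
    -- spectral parameter drives the growth.
    have e : w ^ 2 * (2 * inner ℝ (y x) (D y x)) + 2 * inner ℝ (D y x) ((L.q x - μ) * y x) =
        2 * inner ℝ (D y x) (((w ^ 2 : ℝ) + (L.q x : ℂ) - μ) * y x) := by
      rw [real_inner_comm (D y x) (y x)]
      have : ((w ^ 2 : ℝ) + (L.q x : ℂ) - μ) * y x = (w ^ 2 : ℝ) • y x + (L.q x - μ) * y x := by
        rw [Complex.real_smul]; ring
      rw [this, inner_add_right, inner_smul_right]
      ring
    rw [e, abs_mul, abs_two]
    have h1 : |inner ℝ (D y x) (((w ^ 2 : ℝ) + (L.q x : ℂ) - μ) * y x)| ≤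
        ‖D y x‖ * (K * w * ‖y x‖) := by
      refine (abs_real_inner_le_norm _ _).trans ?_
      rw [norm_mul]
      gcongr
      exact hK x hx
    have hKn : 0 ≤ K := by
      by_contra hneg
      exact absurd ((norm_nonneg _).trans (hK x hx)) (not_le.2 (mul_neg_of_neg_of_pos (not_le.1 hneg) hw))
    nlinarith [mul_nonneg hKn (sq_nonneg (w * ‖y x‖ - ‖D y x‖))]
  have := le_mul_exp_of_abs_deriv_le hd hb hx hx₀
  simpa only [mul_pow] using this

lemma exists_abs_q_le (hq : ContinuousOn L.q (Icc 0 1)) :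
    ∃ B : ℝ, 0 ≤ B ∧ ∀ x ∈ Icc (0 : ℝ) 1, |L.q x| ≤ B := by
  obtain ⟨B, hB⟩ := isCompact_Icc.exists_bound_of_continuousOn hq
  exact ⟨B, (norm_nonneg _).trans (hB 0 (by simp)), hB⟩

lemma IsSolution.eq_zero (hq : ContinuousOn L.q (Icc 0 1)) (h : L.IsSolution μ y) {x₀ : ℝ}
    (hx₀ : x₀ ∈ Icc (0 : ℝ) 1) (h0 : y x₀ = 0) (h1 : D y x₀ = 0) {x : ℝ}
    (hx : x ∈ Icc (0 : ℝ) 1) : y x = 0 ∧ D y x = 0 := by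
  obtain ⟨B, hB0, hB⟩ := exists_abs_q_le hq
  have := h.energy_le (w := 1) (K := 1 + B + ‖μ‖) one_pos (fun x hx => by
    refine (norm_sub_le _ _).trans ?_
    rw [mul_one]
    gcongr
    refine (norm_add_le _ _).trans ?_
    gcongr
    · simp
    · rw [Complex.norm_real]; exact hB x hx) hx hx₀
  rw [h0, h1] at this
  simp only [one_mul, norm_zero, ne_eq, OfNat.ofNat_ne_zero, not_false_eq_true, zero_pow, add_zero,
    zero_mul] at this
  constructor
  · have : ‖y x‖ ^ 2 = 0 := by nlinarith [sq_nonneg ‖y x‖, sq_nonneg ‖D y x‖]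
    simpa using this
  · have : ‖D y x‖ ^ 2 = 0 := by nlinarith [sq_nonneg ‖y x‖, sq_nonneg ‖D y x‖]
    simpa using this

lemma IsSolution.eq_of_eq (hq : ContinuousOn L.q (Icc 0 1)) (hy : L.IsSolution μ y)
    (hz : L.IsSolution μ z) {x₀ : ℝ} (hx₀ : x₀ ∈ Icc (0 : ℝ) 1) (h0 : y x₀ = z x₀)
    (h1 : D y x₀ = D z x₀) {x : ℝ} (hx : x ∈ Icc (0 : ℝ) 1) : y x = z x ∧ D y x = D z x := by
  have := (hy.add_mul hz 1 (-1)).eq_zero hq hx₀ (by rw [h0]; ring)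
    (by rw [D_add_mul hy hz 1 (-1) hx₀, h1]; ring) hx
  rw [D_add_mul hy hz 1 (-1) hx] at this
  exact ⟨by linear_combination this.1, by linear_combination this.2⟩

/-- The energy estimate for `μ = ρ²`. -/
lemma IsSolution.sqrt_energy_le {ρ : ℂ} (h : L.IsSolution (ρ ^ 2) y) {B : ℝ}
    (hB : ∀ x ∈ Icc (0 : ℝ) 1, |L.q x| ≤ B) (hρ : 1 ≤ ‖ρ‖) {x x₀ : ℝ}
    (hx : x ∈ Icc (0 : ℝ) 1) (hx₀ : x₀ ∈ Icc (0 : ℝ) 1) :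
    ‖ρ‖ * ‖y x‖ ≤ (‖ρ‖ * ‖y x₀‖ + ‖D y x₀‖) * Real.exp B * Real.exp (|ρ.im| * |x - x₀|) ∧
      ‖D y x‖ ≤ (‖ρ‖ * ‖y x₀‖ + ‖D y x₀‖) * Real.exp B * Real.exp (|ρ.im| * |x - x₀|) := by
  have hρ0 : 0 < ‖ρ‖ := by linarith
  have hB0 : 0 ≤ B := (abs_nonneg _).trans (hB 0 (by simp))
  -- The rate comes from `|ρ|² - ρ² = -2i ρ Im ρ`, with `|ρ| ≥ 1` absorbing `q`. The energy is
  -- quadratic, so the square root halves `2 |Im ρ|` to the sharp exponent.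
  have := h.energy_le (w := ‖ρ‖) (K := 2 * |ρ.im| + B) hρ0 (fun x hx => by
    have e : ((‖ρ‖ ^ 2 : ℝ) : ℂ) + L.q x - ρ ^ 2 = ρ * (-(2 * ρ.im * Complex.I)) + L.q x := by
      have h1 : ((‖ρ‖ ^ 2 : ℝ) : ℂ) = ρ * (starRingEnd ℂ) ρ := by
        rw [Complex.mul_conj, Complex.normSq_eq_norm_sq]
      have h2 : (starRingEnd ℂ) ρ = ρ - 2 * ρ.im * Complex.I := by
        apply Complex.ext <;> simp; ring
      rw [h1, h2]; ring
    rw [e]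
    refine (norm_add_le _ _).trans ?_
    rw [norm_mul, norm_neg, norm_mul, norm_mul, Complex.norm_I, Complex.norm_real,
      Complex.norm_real, Complex.norm_ofNat, Real.norm_eq_abs, Real.norm_eq_abs]
    have := hB x hx
    nlinarith) hx hx₀
  set a := ‖ρ‖ * ‖y x₀‖
  set b := ‖D y x₀‖
  have ha : 0 ≤ a := by positivity
  have hb : 0 ≤ b := norm_nonneg _
  have hle : (a ^ 2 + b ^ 2) * Real.exp ((2 * |ρ.im| + B) * |x - x₀|) ≤
      ((a + b) * Real.exp B * Real.exp (|ρ.im| * |x - x₀|)) ^ 2 := by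
    have h1 : |x - x₀| ≤ 1 := by
      rw [abs_le]; constructor <;> linarith [hx.1, hx.2, hx₀.1, hx₀.2]
    have h2 : Real.exp ((2 * |ρ.im| + B) * |x - x₀|) ≤
        (Real.exp B * Real.exp (|ρ.im| * |x - x₀|)) ^ 2 := by
      rw [← Real.exp_add, ← Real.exp_nat_mul]
      apply Real.exp_le_exp.2
      push_cast
      nlinarith [mul_le_mul_of_nonneg_left h1 hB0]
    have h3 : a ^ 2 + b ^ 2 ≤ (a + b) ^ 2 := by nlinarith
    exact (mul_le_mul h3 h2 (Real.exp_pos _).le (sq_nonneg _)).trans_eq (by ring)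
  have h4 := this.trans hle
  constructor
  · refine abs_le_of_sq_le_sq' ?_ (by positivity) |>.2
    nlinarith [sq_nonneg ‖D y x‖]
  · refine abs_le_of_sq_le_sq' ?_ (by positivity) |>.2
    nlinarith [sq_nonneg (‖ρ‖ * ‖y x‖)]

end NonlocalSL

/-! ### Existence and analytic dependence on the spectral parameter -/

/-- Continuous complex functions on `[0,1]`. -/
abbrev CI := C(Icc (0 : ℝ) 1, ℂ)

namespace CI

/-- The extension of a function on `[0,1]` to `ℝ`, constant outside. -/
def ext (g : CI) : ℝ → ℂ := IccExtend zero_le_one g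

lemma continuous_ext (g : CI) : Continuous g.ext := g.continuous.Icc_extend'

lemma ext_apply (g : CI) {x : ℝ} (hx : x ∈ Icc (0 : ℝ) 1) : g.ext x = g ⟨x, hx⟩ :=
  IccExtend_of_mem _ _ hx

/-- The primitive of a function on `[0,1]` vanishing at `0`. -/
def primitive (g : CI) (x : ℝ) : ℂ := ∫ t in (0 : ℝ)..x, g.ext t

lemma hasDerivAt_primitive (g : CI) (x : ℝ) : HasDerivAt g.primitive (g.ext x) x :=
  intervalIntegral.integral_hasDerivAt_right (g.continuous_ext.intervalIntegrable _ _)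
    (g.continuous_ext.stronglyMeasurableAtFilter _ _) g.continuous_ext.continuousAt

lemma continuous_primitive (g : CI) : Continuous g.primitive :=
  continuous_iff_continuousAt.2 fun x => (g.hasDerivAt_primitive x).continuousAt

lemma primitive_zero (g : CI) : g.primitive 0 = 0 := intervalIntegral.integral_same

lemma norm_primitive_le {g : CI} {c : ℝ} {n : ℕ}
    (h : ∀ t : Icc (0 : ℝ) 1, ‖g t‖ ≤ c * ((t : ℝ) ^ n / n.factorial)) (x : Icc (0 : ℝ) 1) :
    ‖g.primitive x‖ ≤ c * ((x : ℝ) ^ (n + 1) / (n + 1).factorial) := by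
  have h1 : ‖g.primitive x‖ ≤ ∫ t in (0 : ℝ)..x, c * (t ^ n / n.factorial) := by
    refine intervalIntegral.norm_integral_le_of_norm_le x.2.1 ?_
      (Continuous.intervalIntegrable (by fun_prop) _ _)
    refine Eventually.of_forall fun t ht => ?_
    have ht' : t ∈ Icc (0 : ℝ) 1 := ⟨ht.1.le, ht.2.trans x.2.2⟩
    rw [g.ext_apply ht']
    exact h ⟨t, ht'⟩
  refine h1.trans_eq ?_
  rw [intervalIntegral.integral_const_mul, intervalIntegral.integral_div, integral_pow,
    Nat.factorial_succ]
  push_cast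
  rw [div_div]
  simp

/-- Integration from `0` as a bounded operator. -/
def J : CI →L[ℂ] CI :=
  LinearMap.mkContinuous
    { toFun := fun g => ⟨fun x => g.primitive x, g.continuous_primitive.comp continuous_subtype_val⟩
      map_add' := fun f g => by
        ext x
        exact intervalIntegral.integral_add (f.continuous_ext.intervalIntegrable _ _)
          (g.continuous_ext.intervalIntegrable _ _)
      map_smul' := fun c g => by
        ext x
        exact intervalIntegral.integral_smul c _ }
    1 (fun g => by
      rw [one_mul]
      refine (ContinuousMap.norm_le _ (norm_nonneg g)).2 fun x => ?_
      have := norm_primitive_le (g := g) (c := ‖g‖) (n := 0)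
        (fun t => by simpa using g.norm_coe_le_norm t) x
      refine this.trans ?_
      simp only [zero_add, pow_one, Nat.factorial_one, Nat.cast_one, div_one]
      exact mul_le_of_le_one_right (norm_nonneg _) x.2.2)

lemma norm_iterate_le (A : CI) (f : CI) (n : ℕ) (x : Icc (0 : ℝ) 1) :
    ‖((J * (J * ContinuousLinearMap.mul ℂ CI A)) ^ n) f x‖ ≤
      ‖A‖ ^ n * ‖f‖ * ((x : ℝ) ^ n / n.factorial) := by
  induction n generalizing x with
  | zero => simpa using f.norm_coe_le_norm x
  | succ n ih =>
    rw [pow_succ']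
    set g := ((J * (J * ContinuousLinearMap.mul ℂ CI A)) ^ n) f with hg
    change ‖(J (J (A * g))) x‖ ≤ _
    have h1 : ∀ t : Icc (0 : ℝ) 1, ‖(A * g) t‖ ≤
        ‖A‖ ^ (n + 1) * ‖f‖ * ((t : ℝ) ^ n / n.factorial) := by
      intro t
      rw [ContinuousMap.mul_apply, norm_mul, pow_succ', mul_assoc, mul_assoc, ← mul_assoc (‖A‖ ^ n)]
      gcongr
      · exact A.norm_coe_le_norm t
      · exact ih t
    -- Two integrations would gain two factorial factors. One suffices, so the gain of the inner one
    -- is thrown away.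
    have h2 : ∀ t : Icc (0 : ℝ) 1, ‖(J (A * g)) t‖ ≤
        ‖A‖ ^ (n + 1) * ‖f‖ * ((t : ℝ) ^ n / n.factorial) := by
      intro t
      refine (norm_primitive_le h1 t).trans ?_
      have h0 := t.2.1
      rw [pow_succ (t : ℝ)]
      gcongr
      · exact mul_le_of_le_one_right (pow_nonneg h0 n) t.2.2
      · omega
    exact norm_primitive_le h2 x

/-- The factorial bound makes some power `K ^ n` of the Volterra operator a strict contraction. Then
`1 - K ^ n` is invertible, and so is its commuting factor `1 - K`. -/
lemma isUnit_one_sub (A : CI) :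
    IsUnit (1 - J * (J * ContinuousLinearMap.mul ℂ CI A)) := by
  set K := J * (J * ContinuousLinearMap.mul ℂ CI A) with hK
  obtain ⟨n, hn⟩ : ∃ n : ℕ, ‖K ^ n‖ < 1 := by
    have ht := FloorSemiring.tendsto_pow_div_factorial_atTop ‖A‖
    obtain ⟨n, hn⟩ := (ht.eventually (gt_mem_nhds one_pos)).exists
    refine ⟨n, lt_of_le_of_lt ?_ hn⟩
    refine ContinuousLinearMap.opNorm_le_bound _ (by positivity) fun f => ?_
    refine (ContinuousMap.norm_le _ (by positivity)).2 fun x => ?_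
    refine (norm_iterate_le A f n x).trans ?_
    have : (x : ℝ) ^ n ≤ 1 := pow_le_one₀ x.2.1 x.2.2
    calc ‖A‖ ^ n * ‖f‖ * ((x : ℝ) ^ n / n.factorial) ≤ ‖A‖ ^ n * ‖f‖ * (1 / n.factorial) := by gcongr
      _ = _ := by ring
  have h1 : IsUnit (1 - K ^ n) := (Units.oneSub (K ^ n) hn).isUnit
  have h2 : (1 - K) * ∑ i ∈ Finset.range n, K ^ i = 1 - K ^ n := mul_neg_geom_sum K n
  have h3 : Commute (1 - K) (∑ i ∈ Finset.range n, K ^ i) := by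
    refine Commute.sum_right _ _ _ fun i _ => ?_
    exact Commute.sub_left (R := CI →L[ℂ] CI) (Commute.one_left _) (Commute.self_pow K i)
  rw [← h2] at h1
  exact (h3.isUnit_mul_iff.1 h1).1

/-- The solution of `y'' = A y` with initial data `a`, `b`. -/
def sol (A : CI) (a b : ℂ) : CI :=
  Ring.inverse (1 - J * (J * ContinuousLinearMap.mul ℂ CI A)) (a • 1 + b • J 1)

/-- The twice integrated differential equation. Nesting the integrals as a first-order system makes
the derivative of the solution visible. -/
lemma sol_eq (A : CI) (a b : ℂ) : sol A a b = a • 1 + J (b • 1 + J (A * sol A a b)) := by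
  have h := Ring.mul_inverse_cancel _ (isUnit_one_sub A)
  have h2 := congrArg (fun T : CI →L[ℂ] CI => T (a • 1 + b • J 1)) h
  change sol A a b - J (J (A * sol A a b)) = a • 1 + b • J 1 at h2
  rw [map_add, map_smul, ← add_assoc, ← h2]
  abel

lemma differentiableAt_mul_left {X : Type*} [NormedRing X] [NormedAlgebra ℂ X] {A : ℂ → X}
    (hA : Differentiable ℂ A) (μ : ℂ) :
    DifferentiableAt ℂ (fun μ => ContinuousLinearMap.mul ℂ X (A μ)) μ :=
  (ContinuousLinearMap.mul ℂ X).differentiableAt.comp μ (hA μ)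

lemma differentiableAt_one_sub_mul_mul {X : Type*} [NormedRing X] [NormedAlgebra ℂ X] {A : ℂ → X}
    {μ : ℂ} (hA : DifferentiableAt ℂ A μ) (T : X) :
    DifferentiableAt ℂ (fun μ => 1 - T * (T * A μ)) μ :=
  ((hA.const_mul T).const_mul T).const_sub 1

lemma differentiable_sol {A : ℂ → CI} (hA : Differentiable ℂ A) (a b : ℂ) :
    Differentiable ℂ fun μ => sol (A μ) a b := by
  intro μ
  unfold sol
  have h1 : DifferentiableAt ℂ (fun μ => 1 - J * (J * ContinuousLinearMap.mul ℂ CI (A μ))) μ := by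
    have h0 : DifferentiableAt ℂ (fun μ => ContinuousLinearMap.mul ℂ CI (A μ)) μ :=
      differentiableAt_mul_left hA μ
    exact differentiableAt_one_sub_mul_mul h0 J
  exact (h1.inverse (isUnit_one_sub (A μ))).clm_apply (differentiableAt_const _)

end CI

namespace NonlocalSL

/-- The coefficient `q - μ` as a continuous function on `[0,1]`. -/
def coeff (L : NonlocalSL) (hq : ContinuousOn L.q (Icc 0 1)) (μ : ℂ) : CI :=
  ⟨fun x => (L.q x : ℂ), Complex.continuous_ofReal.comp hq.domRestrict⟩ - μ • 1

/-- The solution with `y 0 = a`, `y' 0 = b`. -/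
def solFun (L : NonlocalSL) (hq : ContinuousOn L.q (Icc 0 1)) (a b μ : ℂ) (x : ℝ) : ℂ :=
  (CI.sol (L.coeff hq μ) a b).ext x

/-- The derivative of `solFun`. -/
def solFunDeriv (L : NonlocalSL) (hq : ContinuousOn L.q (Icc 0 1)) (a b μ : ℂ) (x : ℝ) : ℂ :=
  (b • 1 + CI.J (L.coeff hq μ * CI.sol (L.coeff hq μ) a b)).ext x

variable {L : NonlocalSL} {μ : ℂ} (hq : ContinuousOn L.q (Icc 0 1)) (a b : ℂ)
include hq

lemma solFun_eq {x : ℝ} (hx : x ∈ Icc (0 : ℝ) 1) : L.solFun hq a b μ x =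
    a + (b • 1 + CI.J (L.coeff hq μ * CI.sol (L.coeff hq μ) a b)).primitive x := by
  unfold solFun
  rw [CI.ext_apply _ hx, CI.sol_eq]
  simp only [ContinuousMap.add_apply, ContinuousMap.smul_apply, ContinuousMap.one_apply,
    smul_eq_mul, mul_one]
  rw [← CI.sol_eq]
  rfl

lemma solFunDeriv_eq {x : ℝ} (hx : x ∈ Icc (0 : ℝ) 1) : L.solFunDeriv hq a b μ x =
    b + (L.coeff hq μ * CI.sol (L.coeff hq μ) a b).primitive x := by
  unfold solFunDeriv
  rw [CI.ext_apply _ hx]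
  simp only [ContinuousMap.add_apply, ContinuousMap.smul_apply, ContinuousMap.one_apply,
    smul_eq_mul, mul_one]
  rfl

lemma hasDeriv_solFun {x : ℝ} (hx : x ∈ Icc (0 : ℝ) 1) :
    HasDerivWithinAt (L.solFun hq a b μ) (L.solFunDeriv hq a b μ x) (Icc 0 1) x := by
  refine HasDerivWithinAt.congr (f := fun x => a +
    (b • 1 + CI.J (L.coeff hq μ * CI.sol (L.coeff hq μ) a b)).primitive x) ?_
    (fun x hx => solFun_eq hq a b hx) (solFun_eq hq a b hx)
  exact ((CI.hasDerivAt_primitive _ x).const_add a).hasDerivWithinAt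

lemma hasDeriv_solFunDeriv {x : ℝ} (hx : x ∈ Icc (0 : ℝ) 1) :
    HasDerivWithinAt (L.solFunDeriv hq a b μ) ((L.q x - μ) * L.solFun hq a b μ x) (Icc 0 1) x := by
  refine HasDerivWithinAt.congr (f := fun x => b +
    (L.coeff hq μ * CI.sol (L.coeff hq μ) a b).primitive x) ?_
    (fun x hx => solFunDeriv_eq hq a b hx) (solFunDeriv_eq hq a b hx)
  refine ((CI.hasDerivAt_primitive _ x).const_add b).hasDerivWithinAt.congr_deriv ?_
  unfold solFun
  rw [CI.ext_apply _ hx, CI.ext_apply _ hx, ContinuousMap.mul_apply]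
  congr 1
  simp [coeff]

lemma isSolution_solFun : L.IsSolution μ (L.solFun hq a b μ) :=
  isSolution_of_hasDeriv (fun _ hx => hasDeriv_solFun hq a b hx)
    fun _ hx => hasDeriv_solFunDeriv hq a b hx

lemma D_solFun {x : ℝ} (hx : x ∈ Icc (0 : ℝ) 1) :
    D (L.solFun hq a b μ) x = L.solFunDeriv hq a b μ x :=
  D_eq hx (hasDeriv_solFun hq a b hx)

lemma solFun_zero : L.solFun hq a b μ 0 = a := by
  rw [solFun_eq hq a b (by simp), CI.primitive_zero, add_zero]

lemma solFunDeriv_zero : L.solFunDeriv hq a b μ 0 = b := by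
  rw [solFunDeriv_eq hq a b (by simp), CI.primitive_zero, add_zero]

lemma differentiable_coeff : Differentiable ℂ (L.coeff hq) := by
  unfold coeff
  exact (differentiable_const _).sub (differentiable_id.smul_const _)

lemma differentiable_solFun {x : ℝ} (hx : x ∈ Icc (0 : ℝ) 1) :
    Differentiable ℂ fun μ => L.solFun hq a b μ x := by
  unfold solFun
  simp only [CI.ext_apply _ hx]
  exact (ContinuousMap.evalCLM ℂ (⟨x, hx⟩ : Icc (0 : ℝ) 1)).differentiable.comp
    (CI.differentiable_sol (differentiable_coeff hq) a b)

lemma differentiable_solFunDeriv {x : ℝ} (hx : x ∈ Icc (0 : ℝ) 1) :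
    Differentiable ℂ fun μ => L.solFunDeriv hq a b μ x := by
  unfold solFunDeriv
  simp only [CI.ext_apply _ hx]
  have h1 : Differentiable ℂ fun μ => L.coeff hq μ * CI.sol (L.coeff hq μ) a b :=
    (differentiable_coeff hq).mul (CI.differentiable_sol (differentiable_coeff hq) a b)
  have h2 : Differentiable ℂ fun μ => CI.J (L.coeff hq μ * CI.sol (L.coeff hq μ) a b) :=
    CI.J.differentiable.comp h1
  exact (ContinuousMap.evalCLM ℂ (⟨x, hx⟩ : Icc (0 : ℝ) 1)).differentiable.comp
    (h2.const_add (b • (1 : CI)))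

end NonlocalSL

/-! ### The characteristic function -/

lemma norm_exp_mul_I_le (z : ℂ) : ‖Complex.exp (z * Complex.I)‖ ≤ Real.exp |z.im| := by
  rw [Complex.norm_exp]
  apply Real.exp_le_exp.2
  simpa using neg_le_abs z.im

lemma norm_exp_neg_mul_I_le (z : ℂ) : ‖Complex.exp (-z * Complex.I)‖ ≤ Real.exp |z.im| := by
  simpa using norm_exp_mul_I_le (-z)

lemma norm_cos_le_exp (z : ℂ) : ‖Complex.cos z‖ ≤ Real.exp |z.im| := by
  rw [Complex.cos, norm_div, Complex.norm_ofNat, div_le_iff₀ two_pos]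
  refine (norm_add_le _ _).trans ?_
  linarith [norm_exp_mul_I_le z, norm_exp_neg_mul_I_le z]

lemma _root_.HasDerivAt.ccos_real {g : ℝ → ℂ} {g' : ℂ} {t : ℝ} (h : HasDerivAt g g' t) :
    HasDerivAt (fun t => Complex.cos (g t)) (-Complex.sin (g t) * g') t :=
  ((Complex.hasDerivAt_cos (g t)).scomp t h).congr_deriv (mul_comm _ _)

lemma _root_.HasDerivAt.csin_real {g : ℝ → ℂ} {g' : ℂ} {t : ℝ} (h : HasDerivAt g g' t) :
    HasDerivAt (fun t => Complex.sin (g t)) (Complex.cos (g t) * g') t :=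
  ((Complex.hasDerivAt_sin (g t)).scomp t h).congr_deriv (mul_comm _ _)

namespace NonlocalSL

variable {L : NonlocalSL} {μ : ℂ} {y : ℝ → ℂ}

lemma zero_mem : (0 : ℝ) ∈ Icc (0 : ℝ) 1 := by simp

lemma one_mem : (1 : ℝ) ∈ Icc (0 : ℝ) 1 := by simp

section
variable (hq : ContinuousOn L.q (Icc 0 1)) (μ)
include hq

lemma C_spec : L.IsSolution μ (L.C μ) ∧ L.C μ 0 = 1 ∧ D (L.C μ) 0 = 0 :=
  Classical.epsilon_spec (p := fun y => L.IsSolution μ y ∧ y 0 = 1 ∧ D y 0 = 0)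
    ⟨L.solFun hq 1 0 μ, isSolution_solFun hq 1 0, solFun_zero hq 1 0,
      by rw [D_solFun hq 1 0 zero_mem, solFunDeriv_zero]⟩

lemma S_spec : L.IsSolution μ (L.S μ) ∧ L.S μ 0 = 0 ∧ D (L.S μ) 0 = 1 :=
  Classical.epsilon_spec (p := fun y => L.IsSolution μ y ∧ y 0 = 0 ∧ D y 0 = 1)
    ⟨L.solFun hq 0 1 μ, isSolution_solFun hq 0 1, solFun_zero hq 0 1,
      by rw [D_solFun hq 0 1 zero_mem, solFunDeriv_zero]⟩

/-- Uniqueness identifies the chosen solution with the constructed one on `[0,1]`, which transfers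
analyticity in `μ`. -/
lemma C_eq_solFun {x : ℝ} (hx : x ∈ Icc (0 : ℝ) 1) :
    L.C μ x = L.solFun hq 1 0 μ x ∧ D (L.C μ) x = L.solFunDeriv hq 1 0 μ x := by
  obtain ⟨h1, h2, h3⟩ := C_spec μ hq
  rw [← D_solFun hq 1 0 hx]
  exact h1.eq_of_eq hq (isSolution_solFun hq 1 0) zero_mem (by rw [h2, solFun_zero])
    (by rw [h3, D_solFun hq 1 0 zero_mem, solFunDeriv_zero]) hx

lemma S_eq_solFun {x : ℝ} (hx : x ∈ Icc (0 : ℝ) 1) :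
    L.S μ x = L.solFun hq 0 1 μ x ∧ D (L.S μ) x = L.solFunDeriv hq 0 1 μ x := by
  obtain ⟨h1, h2, h3⟩ := S_spec μ hq
  rw [← D_solFun hq 0 1 hx]
  exact h1.eq_of_eq hq (isSolution_solFun hq 0 1) zero_mem (by rw [h2, solFun_zero])
    (by rw [h3, D_solFun hq 0 1 zero_mem, solFunDeriv_zero]) hx

end

lemma IsSolution.eq_C_S (hq : ContinuousOn L.q (Icc 0 1)) (h : L.IsSolution μ y) {x : ℝ}
    (hx : x ∈ Icc (0 : ℝ) 1) : y x = y 0 * L.C μ x + D y 0 * L.S μ x ∧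
      D y x = y 0 * D (L.C μ) x + D y 0 * D (L.S μ) x := by
  obtain ⟨c1, c2, c3⟩ := C_spec μ hq
  obtain ⟨s1, s2, s3⟩ := S_spec μ hq
  rw [← D_add_mul c1 s1 _ _ hx]
  exact h.eq_of_eq hq (c1.add_mul s1 (y 0) (D y 0)) zero_mem (by rw [c2, s2]; ring)
    (by rw [D_add_mul c1 s1 _ _ zero_mem, c3, s3]; ring) hx

lemma charFun_eq (hq : ContinuousOn L.q (Icc 0 1)) (μ : ℂ) : L.charFun μ =
    (L.h - L.γ₀ * L.C μ L.ξ₀) * (D (L.S μ) 1 + L.H * L.S μ 1 - L.γ₁ * L.S μ L.ξ₁) -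
    (1 - L.γ₀ * L.S μ L.ξ₀) * (D (L.C μ) 1 + L.H * L.C μ 1 - L.γ₁ * L.C μ L.ξ₁) := by
  obtain ⟨-, c2, c3⟩ := C_spec μ hq
  obtain ⟨-, s2, s3⟩ := S_spec μ hq
  rw [charFun, Matrix.det_fin_two_of, U, U, V, V, c2, c3, s2, s3]
  ring

lemma differentiable_charFun (hq : ContinuousOn L.q (Icc 0 1)) (hξ₀ : L.ξ₀ ∈ Icc (0 : ℝ) 1)
    (hξ₁ : L.ξ₁ ∈ Icc (0 : ℝ) 1) : Differentiable ℂ L.charFun := by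
  have e : L.charFun = fun μ => _ := funext fun μ => charFun_eq hq μ
  rw [e]
  simp_rw [(C_eq_solFun _ hq hξ₀).1, (C_eq_solFun _ hq hξ₁).1, (C_eq_solFun _ hq one_mem).1,
    (C_eq_solFun _ hq one_mem).2, (S_eq_solFun _ hq hξ₀).1, (S_eq_solFun _ hq hξ₁).1,
    (S_eq_solFun _ hq one_mem).1, (S_eq_solFun _ hq one_mem).2]
  have c0 := differentiable_solFun hq 1 0 hξ₀
  have c1 := differentiable_solFun hq 1 0 hξ₁
  have c2 := differentiable_solFun hq 1 0 one_mem
  have c3 := differentiable_solFunDeriv hq 1 0 one_mem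
  have s0 := differentiable_solFun hq 0 1 hξ₀
  have s1 := differentiable_solFun hq 0 1 hξ₁
  have s2 := differentiable_solFun hq 0 1 one_mem
  have s3 := differentiable_solFunDeriv hq 0 1 one_mem
  fun_prop

/-! #### Conjugation symmetry -/

open ComplexConjugate in
lemma IsSolution.conj (h : L.IsSolution μ y) :
    L.IsSolution (conj μ) (fun x => conj (y x)) ∧
      ∀ x ∈ Icc (0 : ℝ) 1, D (fun x => conj (y x)) x = conj (D y x) := by
  have h1 : ∀ x ∈ Icc (0 : ℝ) 1,
      HasDerivWithinAt (fun x => conj (y x)) (conj (D y x)) (Icc 0 1) x :=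
    fun x hx => (h.hasDeriv hx).star
  refine ⟨isSolution_of_hasDeriv h1 fun x hx => ?_, fun x hx => D_eq hx (h1 x hx)⟩
  refine (h.hasDeriv_D hx).star.congr_deriv ?_
  change conj ((L.q x - μ) * y x) = _
  rw [map_mul, map_sub, Complex.conj_ofReal]

section
open ComplexConjugate
variable (hq : ContinuousOn L.q (Icc 0 1)) (μ)
include hq

lemma C_conj {x : ℝ} (hx : x ∈ Icc (0 : ℝ) 1) :
    L.C (conj μ) x = conj (L.C μ x) ∧ D (L.C (conj μ)) x = conj (D (L.C μ) x) := by
  obtain ⟨h1, h2, h3⟩ := C_spec μ hq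
  obtain ⟨g1, g2, g3⟩ := C_spec (conj μ) hq
  rw [← h1.conj.2 x hx]
  refine g1.eq_of_eq hq h1.conj.1 zero_mem ?_ ?_ hx
  · rw [g2, h2, map_one]
  · rw [g3, h1.conj.2 0 zero_mem, h3, map_zero]

lemma S_conj {x : ℝ} (hx : x ∈ Icc (0 : ℝ) 1) :
    L.S (conj μ) x = conj (L.S μ x) ∧ D (L.S (conj μ)) x = conj (D (L.S μ) x) := by
  obtain ⟨h1, h2, h3⟩ := S_spec μ hq
  obtain ⟨g1, g2, g3⟩ := S_spec (conj μ) hq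
  rw [← h1.conj.2 x hx]
  refine g1.eq_of_eq hq h1.conj.1 zero_mem ?_ ?_ hx
  · rw [g2, h2, map_zero]
  · rw [g3, h1.conj.2 0 zero_mem, h3, map_one]

lemma charFun_conj (hξ₀ : L.ξ₀ ∈ Icc (0 : ℝ) 1) (hξ₁ : L.ξ₁ ∈ Icc (0 : ℝ) 1) :
    L.charFun (conj μ) = conj (L.charFun μ) := by
  rw [charFun_eq hq, charFun_eq hq, (C_conj μ hq hξ₀).1, (C_conj μ hq hξ₁).1,
    (C_conj μ hq one_mem).1, (C_conj μ hq one_mem).2, (S_conj μ hq hξ₀).1, (S_conj μ hq hξ₁).1,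
    (S_conj μ hq one_mem).1, (S_conj μ hq one_mem).2]
  simp only [map_sub, map_mul, map_add, Complex.conj_ofReal, map_one]

end

/-! #### Asymptotics of the characteristic function -/

lemma wronskian (hq : ContinuousOn L.q (Icc 0 1)) (μ : ℂ) {x : ℝ} (hx : x ∈ Icc (0 : ℝ) 1) :
    L.C μ x * D (L.S μ) x - L.S μ x * D (L.C μ) x = 1 := by
  obtain ⟨c1, c2, c3⟩ := C_spec μ hq
  obtain ⟨s1, s2, s3⟩ := S_spec μ hq
  have hd : ∀ x ∈ Icc (0 : ℝ) 1, HasDerivWithinAt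
      (fun x => L.C μ x * D (L.S μ) x - L.S μ x * D (L.C μ) x) 0 (Icc 0 1) x := fun x hx =>
    (((c1.hasDeriv hx).mul (s1.hasDeriv_D hx)).sub
      ((s1.hasDeriv hx).mul (c1.hasDeriv_D hx))).congr_deriv (by ring)
  have := constant_of_derivWithin_zero (fun x hx => (hd x hx).differentiableWithinAt)
    (fun x hx => (hd x (Ico_subset_Icc_self hx)).derivWithin
      (uniqueDiffWithinAt_Icc (Ico_subset_Icc_self hx))) x hx
  rw [this, c2, s2, s3]
  ring

lemma hasDerivAt_mul_one_sub (ρ : ℂ) (x t : ℝ) :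
    HasDerivAt (fun t : ℝ => ρ * ((x : ℂ) - (t : ℂ))) (-ρ) t := by
  have : HasDerivAt (fun t : ℝ => (t : ℂ)) 1 t := Complex.ofRealCLM.hasDerivAt
  simpa using (this.const_sub (x : ℂ)).const_mul ρ

/-- Variation of constants as a mean value estimate: `y' cos(ρ(1-t)) - ρ y sin(ρ(1-t))` runs from
`-ρ sin ρ` at `0` to `y'(1)` at `1`, with derivative `q y cos(ρ(1-t))`. The growth factors `exp(|Im
ρ| t)` and `exp(|Im ρ| (1-t))` multiply to `exp |Im ρ|`. -/
lemma norm_D_C_one_add_le (hq : ContinuousOn L.q (Icc 0 1)) {B : ℝ}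
    (hB : ∀ x ∈ Icc (0 : ℝ) 1, |L.q x| ≤ B) {ρ : ℂ} (hρ : 1 ≤ ‖ρ‖) :
    ‖D (L.C (ρ ^ 2)) 1 + ρ * Complex.sin ρ‖ ≤ B * Real.exp B * Real.exp |ρ.im| := by
  obtain ⟨c1, c2, c3⟩ := C_spec (ρ ^ 2) hq
  have hρ0 : 0 < ‖ρ‖ := by linarith
  set y := L.C (ρ ^ 2)
  have hd : ∀ t ∈ Icc (0 : ℝ) 1, HasDerivWithinAt
      (fun t : ℝ => D y t * Complex.cos (ρ * ((1 : ℝ) - t)) -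
        ρ * (y t * Complex.sin (ρ * ((1 : ℝ) - t))))
      (L.q t * y t * Complex.cos (ρ * ((1 : ℝ) - t))) (Icc 0 1) t := fun t ht => by
    have h0 := (hasDerivAt_mul_one_sub ρ 1 t)
    exact (((c1.hasDeriv_D ht).mul h0.ccos_real.hasDerivWithinAt).sub
      (((c1.hasDeriv ht).mul h0.csin_real.hasDerivWithinAt).const_mul ρ)).congr_deriv (by ring)
  have hb : ∀ t ∈ Icc (0 : ℝ) 1, ‖(L.q t : ℂ) * y t * Complex.cos (ρ * ((1 : ℝ) - t))‖ ≤
      B * Real.exp B * Real.exp |ρ.im| := by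
    intro t ht
    have h1 := (c1.sqrt_energy_le hB hρ ht zero_mem).1
    rw [c2, c3, norm_one, norm_zero, mul_one, add_zero, mul_assoc] at h1
    have h2 := le_of_mul_le_mul_left h1 hρ0
    have h3 : ‖Complex.cos (ρ * ((1 : ℝ) - t))‖ ≤ Real.exp (|ρ.im| * (1 - t)) := by
      refine (norm_cos_le_exp _).trans_eq ?_
      congr 1
      rw [← Complex.ofReal_sub, Complex.im_mul_ofReal, abs_mul, abs_of_nonneg (sub_nonneg.2 ht.2)]
    have hqB : ‖L.q t‖ ≤ B := hB t ht
    have hB0 : 0 ≤ B := (norm_nonneg _).trans hqB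
    rw [norm_mul, norm_mul, Complex.norm_real]
    calc ‖L.q t‖ * ‖y t‖ * ‖Complex.cos (ρ * ((1 : ℝ) - t))‖
        ≤ B * (Real.exp B * Real.exp (|ρ.im| * |t - 0|)) * Real.exp (|ρ.im| * (1 - t)) := by
          gcongr
      _ = B * Real.exp B * (Real.exp (|ρ.im| * t) * Real.exp (|ρ.im| * (1 - t))) := by
          rw [sub_zero, abs_of_nonneg ht.1]; ring
      _ = _ := by rw [← Real.exp_add]; ring_nf
  have := Convex.norm_image_sub_le_of_norm_hasDerivWithin_le hd hb (convex_Icc 0 1)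
    zero_mem one_mem
  simpa [c2, c3] using this

/-- The characteristic function is a bounded perturbation of `ρ sin ρ`. -/
theorem exists_norm_charFun_sub_le (hq : ContinuousOn L.q (Icc 0 1))
    (hξ₀ : L.ξ₀ ∈ Icc (0 : ℝ) 1) (hξ₁ : L.ξ₁ ∈ Icc (0 : ℝ) 1) :
    ∃ K : ℝ, 0 ≤ K ∧ ∀ ρ : ℂ, 1 ≤ ‖ρ‖ →
      ‖L.charFun (ρ ^ 2) - ρ * Complex.sin ρ‖ ≤ K * Real.exp |ρ.im| := by
  obtain ⟨B, hB0, hB⟩ := exists_abs_q_le hq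
  refine ⟨(B + (|L.h| + |L.γ₀|) + |L.H| * (|L.h| + 1 + |L.γ₀|) +
    |L.γ₁| * (|L.h| + 1 + |L.γ₀|)) * Real.exp B, by positivity, fun ρ hρ => ?_⟩
  have hρ0 : 0 < ‖ρ‖ := by linarith
  obtain ⟨c1, c2, c3⟩ := C_spec (ρ ^ 2) hq
  obtain ⟨s1, s2, s3⟩ := S_spec (ρ ^ 2) hq
  set E := Real.exp B * Real.exp |ρ.im| with hE
  have hmono {x x₀ : ℝ} (hx : x ∈ Icc (0 : ℝ) 1) (hx₀ : x₀ ∈ Icc (0 : ℝ) 1) :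
      Real.exp (|ρ.im| * |x - x₀|) ≤ Real.exp |ρ.im| := by
    apply Real.exp_le_exp.2
    refine mul_le_of_le_one_right (abs_nonneg _) ?_
    rw [abs_le]; constructor <;> linarith [hx.1, hx.2, hx₀.1, hx₀.2]
  have hC {x : ℝ} (hx : x ∈ Icc (0 : ℝ) 1) : ‖L.C (ρ ^ 2) x‖ ≤ E := by
    have h1 := (c1.sqrt_energy_le hB hρ hx zero_mem).1
    rw [c2, c3, norm_one, norm_zero, mul_one, add_zero, mul_assoc] at h1
    refine (le_of_mul_le_mul_left h1 hρ0).trans ?_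
    have := hmono hx zero_mem
    rw [hE]; gcongr
  have hone {z : ℝ → ℂ} (hz : L.IsSolution (ρ ^ 2) z) {x x₀ : ℝ} (hx : x ∈ Icc (0 : ℝ) 1)
      (hx₀ : x₀ ∈ Icc (0 : ℝ) 1) (h0 : z x₀ = 0) (h1 : D z x₀ = 1) : ‖z x‖ ≤ E ∧ ‖D z x‖ ≤ E := by
    have h2 := hz.sqrt_energy_le hB hρ hx hx₀
    rw [h0, h1, norm_one, norm_zero, mul_zero, zero_add, one_mul] at h2
    have h3 : Real.exp B * Real.exp (|ρ.im| * |x - x₀|) ≤ E := by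
      have := hmono hx hx₀
      rw [hE]; gcongr
    refine ⟨?_, h2.2.trans h3⟩
    nlinarith [h2.1, norm_nonneg (z x)]
  -- Products such as `S(ξ₀) C'(1)` alone may grow like `exp(|Im ρ| (1 + ξ₀))`. They occur only in
  -- the combination `s`, which by the Wronskian is the solution with `s(ξ₀) = 0`, `s'(ξ₀) = 1`, and
  -- hence grows no faster than `exp |Im ρ|`.
  have hs := c1.add_mul s1 (-L.S (ρ ^ 2) L.ξ₀) (L.C (ρ ^ 2) L.ξ₀)
  have hDs {x : ℝ} (hx : x ∈ Icc (0 : ℝ) 1) :=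
    D_add_mul c1 s1 (-L.S (ρ ^ 2) L.ξ₀) (L.C (ρ ^ 2) L.ξ₀) hx
  set s := fun t => -L.S (ρ ^ 2) L.ξ₀ * L.C (ρ ^ 2) t + L.C (ρ ^ 2) L.ξ₀ * L.S (ρ ^ 2) t with hsdef
  have hs0 : s L.ξ₀ = 0 := by rw [hsdef]; ring
  have hs1 : D s L.ξ₀ = 1 := by
    rw [hDs hξ₀]
    linear_combination wronskian hq (ρ ^ 2) hξ₀
  have e : L.charFun (ρ ^ 2) - ρ * Complex.sin ρ =
      -(D (L.C (ρ ^ 2)) 1 + ρ * Complex.sin ρ) + (L.h * D (L.S (ρ ^ 2)) 1 - L.γ₀ * D s 1) +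
      L.H * (L.h * L.S (ρ ^ 2) 1 - L.C (ρ ^ 2) 1 - L.γ₀ * s 1) -
      L.γ₁ * (L.h * L.S (ρ ^ 2) L.ξ₁ - L.C (ρ ^ 2) L.ξ₁ - L.γ₀ * s L.ξ₁) := by
    rw [charFun_eq hq, hDs one_mem, hsdef]
    ring
  have hr (c : ℝ) : ‖(c : ℂ)‖ = |c| := Complex.norm_real c
  have hbr {x : ℝ} (hx : x ∈ Icc (0 : ℝ) 1) :
      ‖(L.h : ℂ) * L.S (ρ ^ 2) x - L.C (ρ ^ 2) x - L.γ₀ * s x‖ ≤ (|L.h| + 1 + |L.γ₀|) * E := by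
    refine (norm_sub_le _ _).trans ((add_le_add_left (norm_sub_le _ _) _).trans ?_)
    rw [norm_mul, norm_mul, hr, hr, add_mul, add_mul, one_mul]
    gcongr
    · exact (hone s1 hx zero_mem s2 s3).1
    · exact hC hx
    · exact (hone hs hx hξ₀ hs0 hs1).1
  rw [e]
  have h1 : ‖-(D (L.C (ρ ^ 2)) 1 + ρ * Complex.sin ρ)‖ ≤ B * E := by
    rw [norm_neg, hE, ← mul_assoc]
    exact norm_D_C_one_add_le hq hB hρ
  have h2 : ‖(L.h : ℂ) * D (L.S (ρ ^ 2)) 1 - L.γ₀ * D s 1‖ ≤ (|L.h| + |L.γ₀|) * E := by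
    refine (norm_sub_le _ _).trans ?_
    rw [norm_mul, norm_mul, hr, hr, add_mul]
    gcongr
    · exact (hone s1 one_mem zero_mem s2 s3).2
    · exact (hone hs one_mem hξ₀ hs0 hs1).2
  have h3 : ‖(L.H : ℂ) * (L.h * L.S (ρ ^ 2) 1 - L.C (ρ ^ 2) 1 - L.γ₀ * s 1)‖ ≤
      |L.H| * ((|L.h| + 1 + |L.γ₀|) * E) := by
    rw [norm_mul, hr]
    gcongr
    exact hbr one_mem
  have h4 : ‖(L.γ₁ : ℂ) * (L.h * L.S (ρ ^ 2) L.ξ₁ - L.C (ρ ^ 2) L.ξ₁ - L.γ₀ * s L.ξ₁)‖ ≤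
      |L.γ₁| * ((|L.h| + 1 + |L.γ₀|) * E) := by
    rw [norm_mul, hr]
    gcongr
    exact hbr hξ₁
  refine (norm_sub_le _ _).trans ((add_le_add_left (norm_add₃_le) _).trans ?_)
  calc _ ≤ B * E + (|L.h| + |L.γ₀|) * E + |L.H| * ((|L.h| + 1 + |L.γ₀|) * E) +
        |L.γ₁| * ((|L.h| + 1 + |L.γ₀|) * E) := by gcongr
    _ = _ := by rw [hE]; ring

/-! #### The unperturbed problem -/

/-- The problem with vanishing potential and coefficients. -/
def free : NonlocalSL := ⟨0, 0, 0, 0, 0, 0, 0⟩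

lemma continuousOn_free_q : ContinuousOn free.q (Icc 0 1) := continuousOn_const

lemma differentiable_charFun_free : Differentiable ℂ free.charFun :=
  differentiable_charFun continuousOn_free_q zero_mem zero_mem

lemma charFun_free (ρ : ℂ) : free.charFun (ρ ^ 2) = ρ * Complex.sin ρ := by
  obtain ⟨c1, c2, c3⟩ := C_spec (ρ ^ 2) continuousOn_free_q
  have h0 (t : ℝ) : HasDerivAt (fun t : ℝ => ρ * (t : ℂ)) ρ t := by
    simpa using (Complex.ofRealCLM.hasDerivAt (x := t)).const_mul ρ
  have h1 : ∀ x ∈ Icc (0 : ℝ) 1, HasDerivWithinAt (fun t : ℝ => Complex.cos (ρ * t))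
      (-(ρ * Complex.sin (ρ * x))) (Icc 0 1) x := fun x _ =>
    ((h0 x).ccos_real.congr_deriv (by ring)).hasDerivWithinAt
  have h2 : free.IsSolution (ρ ^ 2) fun t : ℝ => Complex.cos (ρ * t) := by
    refine isSolution_of_hasDeriv h1 fun x _ => ?_
    refine (((h0 x).csin_real.const_mul ρ).neg.congr_deriv ?_).hasDerivWithinAt
    simp [free]; ring
  have h3 := (c1.eq_of_eq continuousOn_free_q h2 zero_mem (by simp [c2])
    (by rw [c3, D_eq zero_mem (h1 0 zero_mem)]; simp) one_mem).2
  rw [D_eq one_mem (h1 1 one_mem)] at h3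
  rw [charFun_eq continuousOn_free_q, h3]
  simp [free]

end NonlocalSL

/-! ### Localization of the eigenvalues -/

lemma normSq_sin (z : ℂ) :
    ‖Complex.sin z‖ ^ 2 = Real.cosh z.im ^ 2 - Real.cos z.re ^ 2 := by
  rw [Complex.sin_eq, ← Complex.ofReal_sin, ← Complex.ofReal_cos, ← Complex.ofReal_cosh,
    ← Complex.ofReal_sinh, ← Complex.ofReal_mul, ← Complex.ofReal_mul, Complex.sq_norm,
    Complex.normSq_add_mul_I]
  nlinarith [Real.sin_sq_add_cos_sq z.re, Real.cosh_sq z.im]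

/-- The hypothesis expresses distance from the zeros of the sine: `|sin z|² = cosh² - cos²` is then
at least `cosh² / 4`. It will be checked on the Rouché circles and on the imaginary axis away from
`0`. -/
lemma exp_abs_le_norm_sin {z : ℂ} (h : Real.cos z.re ^ 2 ≤ 3 / 4 * Real.cosh z.im ^ 2) :
    Real.exp |z.im| / 4 ≤ ‖Complex.sin z‖ := by
  refine abs_le_of_sq_le_sq' ?_ (norm_nonneg _) |>.2
  rw [normSq_sin]
  have h1 : Real.exp |z.im| / 2 ≤ Real.cosh z.im := by
    rw [← Real.cosh_abs, Real.cosh_eq]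
    linarith [Real.exp_pos (-|z.im|)]
  nlinarith [Real.exp_pos |z.im|]

lemma one_add_sq_le_cosh_sq (b : ℝ) : 1 + b ^ 2 ≤ Real.cosh b ^ 2 := by
  rw [Real.cosh_sq]
  have h1 : |b| ≤ Real.sinh |b| := Real.self_le_sinh_iff.2 (abs_nonneg b)
  have h2 : |b| ^ 2 ≤ Real.sinh |b| ^ 2 := by gcongr
  rw [sq_abs, ← Real.abs_sinh, sq_abs] at h2
  linarith

lemma cos_nat_add_half_mul_pi (N : ℕ) : Real.cos ((N + 1 / 2) * Real.pi) = 0 := by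
  rw [Real.cos_eq_zero_iff]
  exact ⟨N, by push_cast; ring⟩

lemma cos_sq_le_of_norm_eq {z : ℂ} {N : ℕ} (hz : ‖z‖ = (N + 1 / 2) * Real.pi) :
    Real.cos z.re ^ 2 ≤ 3 / 4 * Real.cosh z.im ^ 2 := by
  have hc := one_add_sq_le_cosh_sq z.im
  -- If `(Im z)² ≥ 1/3`, already `cosh² ≥ 4/3`. Otherwise `|Re z|` lies within `1/2` of the radius,
  -- where the cosine vanishes.
  rcases le_total (1 / 3) (z.im ^ 2) with h | h
  · nlinarith [Real.cos_sq_le_one z.re]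
  · set R := ‖z‖ with hR
    have hR1 : 1 ≤ R := by
      rw [hz]
      nlinarith [Real.pi_gt_three, (Nat.cast_nonneg N : (0 : ℝ) ≤ N)]
    have h1 : R ^ 2 = |z.re| ^ 2 + z.im ^ 2 := by
      rw [hR, Complex.sq_norm, Complex.normSq_apply, sq_abs]; ring
    have hle : |z.re| ≤ R := Complex.abs_re_le_norm z
    have h0 := abs_nonneg z.re
    have h2 : R - |z.re| ≤ 1 / 2 := by nlinarith
    have h3 : Real.cos z.re = Real.sin R * Real.sin (R - |z.re|) := by
      have : Real.cos z.re = Real.cos (R - (R - |z.re|)) := by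
        rw [sub_sub_cancel, Real.cos_abs]
      rw [this, Real.cos_sub, hz, cos_nat_add_half_mul_pi]
      ring
    have h4 : Real.sin (R - |z.re|) ^ 2 ≤ (R - |z.re|) ^ 2 := by
      rw [sq_le_sq]
      exact Real.abs_sin_le_abs
    rw [h3, mul_pow]
    nlinarith [Real.sin_sq_le_one R, sq_nonneg (Real.sin (R - |z.re|))]

namespace NonlocalSL

variable {L : NonlocalSL}

/-! #### Zeros of the unperturbed characteristic function -/

lemma hasDerivAt_charFun_free_sq (ρ : ℂ) :
    2 * ρ * deriv free.charFun (ρ ^ 2) = Complex.sin ρ + ρ * Complex.cos ρ := by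
  have h1 : HasDerivAt (fun ρ => free.charFun (ρ ^ 2)) (deriv free.charFun (ρ ^ 2) * (2 * ρ)) ρ := by
    have := (differentiable_charFun_free (ρ ^ 2)).hasDerivAt.comp ρ (hasDerivAt_pow 2 ρ)
    exact this.congr_deriv (by simp)
  have h2 : HasDerivAt (fun ρ => free.charFun (ρ ^ 2)) (Complex.sin ρ + ρ * Complex.cos ρ) ρ := by
    simp_rw [charFun_free]
    exact ((hasDerivAt_id ρ).mul (Complex.hasDerivAt_sin ρ)).congr_deriv (by simp)
  rw [← h1.unique h2]
  ring

/-- At `ρ = 0` the differentiated identity reads `0 = 0`, so it is differentiated once more. -/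
lemma deriv_charFun_free_zero : deriv free.charFun 0 = 1 := by
  have hF : DifferentiableAt ℂ (deriv free.charFun) ((0 : ℂ) ^ 2) :=
    (differentiable_charFun_free.analyticAt _).deriv.differentiableAt
  have h1 : HasDerivAt (fun ρ : ℂ => 2 * ρ * deriv free.charFun (ρ ^ 2))
      (2 * deriv free.charFun 0) 0 := by
    have h3 := hF.hasDerivAt.comp (0 : ℂ) (hasDerivAt_pow 2 (0 : ℂ))
    exact (((hasDerivAt_id (0 : ℂ)).const_mul 2).mul h3).congr_deriv (by simp)
  have h2 : HasDerivAt (fun ρ : ℂ => 2 * ρ * deriv free.charFun (ρ ^ 2)) 2 0 := by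
    simp_rw [hasDerivAt_charFun_free_sq]
    have := (Complex.hasDerivAt_sin 0).add ((hasDerivAt_id (0 : ℂ)).mul (Complex.hasDerivAt_cos 0))
    refine this.congr_deriv ?_
    simp; norm_num
  have := h1.unique h2
  linear_combination this / 2

lemma analyticOrderNatAt_charFun_free (k : ℕ) :
    analyticOrderNatAt free.charFun ((k * Real.pi : ℂ) ^ 2) = 1 := by
  have hsin : Complex.sin (k * Real.pi) = 0 := Complex.sin_nat_mul_pi k
  have : analyticOrderAt free.charFun ((k * Real.pi : ℂ) ^ 2) = 1 := by
    refine AnalyticAt.analyticOrderAt_eq_one_of_zero_deriv_ne_zero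
      (differentiable_charFun_free.analyticAt _) (by rw [charFun_free, hsin, mul_zero]) ?_
    rcases Nat.eq_zero_or_pos k with rfl | hk
    · simp [deriv_charFun_free_zero]
    · intro h0
      have h1 := hasDerivAt_charFun_free_sq (k * Real.pi)
      rw [h0, hsin, mul_zero, zero_add] at h1
      have h2 : Complex.cos (k * Real.pi) ≠ 0 := by
        intro hc
        have := Complex.sin_sq_add_cos_sq (k * Real.pi : ℂ)
        rw [hsin, hc] at this
        simp at this
      have h3 : (k * Real.pi : ℂ) ≠ 0 := by
        simp [hk.ne', Real.pi_ne_zero]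
      exact mul_ne_zero h3 h2 h1.symm
  simp [analyticOrderNatAt, this]

lemma charFun_free_ne_zero : free.charFun ((Real.pi / 2 : ℂ) ^ 2) ≠ 0 := by
  rw [charFun_free, Complex.sin_pi_div_two]
  simp [Real.pi_ne_zero]

/-- In the variable `μ = ρ ^ 2` the zeros `k π` and `-k π` merge and are simple, so the disc
contains one for each `k = 0, …, N`. -/
lemma zeroCount_charFun_free (N : ℕ) :
    zeroCount free.charFun (((N + 1 / 2) * Real.pi) ^ 2) = N + 1 := by
  have hpi := Real.pi_pos
  have hset : Metric.ball (0 : ℂ) (((N + 1 / 2) * Real.pi) ^ 2) ∩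
      Function.support (analyticOrderNatAt free.charFun) =
      (Finset.range (N + 1)).image (fun k : ℕ => (k * Real.pi : ℂ) ^ 2) := by
    ext z
    simp only [mem_inter_iff, Metric.mem_ball, dist_zero_right, Function.mem_support,
      Finset.coe_image, Finset.coe_range, mem_image, mem_Iio]
    constructor
    · rintro ⟨hz, h0⟩
      obtain ⟨ρ, rfl⟩ := IsAlgClosed.exists_pow_nat_eq z two_pos
      rw [Ne, analyticOrderNatAt_eq_zero_iff differentiable_charFun_free charFun_free_ne_zero,
        not_not, charFun_free] at h0
      obtain ⟨k, hk⟩ : ∃ k : ℤ, ρ = k * Real.pi := by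
        rcases mul_eq_zero.1 h0 with h | h
        · exact ⟨0, by simp [h]⟩
        · obtain ⟨k, hk⟩ := Complex.sin_eq_zero_iff.1 h
          exact ⟨k, hk⟩
      refine ⟨k.natAbs, ?_, ?_⟩
      · have h1 : ‖ρ‖ = k.natAbs * Real.pi := by
          rw [hk, norm_mul, Complex.norm_intCast, Complex.norm_real, Real.norm_of_nonneg hpi.le,
            Nat.cast_natAbs, Int.cast_abs]
        rw [norm_pow, sq_lt_sq₀ (norm_nonneg _) (by positivity), h1,
          mul_lt_mul_iff_left₀ hpi] at hz
        have : (k.natAbs : ℝ) < N + 1 := by linarith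
        exact_mod_cast this
      · rw [hk, mul_pow, mul_pow]
        congr 1
        have : ((k.natAbs : ℤ) : ℂ) ^ 2 = (k : ℂ) ^ 2 := by
          rw [← Int.cast_pow, ← Int.cast_pow, Int.natAbs_sq]
        simpa using this
    · rintro ⟨k, hk, rfl⟩
      refine ⟨?_, by rw [analyticOrderNatAt_charFun_free]; exact one_ne_zero⟩
      rw [norm_pow, sq_lt_sq₀ (norm_nonneg _) (by positivity), norm_mul, Complex.norm_real,
        Complex.norm_natCast, Real.norm_of_nonneg hpi.le, mul_lt_mul_iff_left₀ hpi]
      have : (k : ℝ) ≤ N := by exact_mod_cast Nat.lt_succ_iff.1 hk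
      linarith
  have hinj : Function.Injective fun k : ℕ => (k * Real.pi : ℂ) ^ 2 := by
    intro a b hab
    have h1 : ((a * Real.pi : ℝ)) ^ 2 = (b * Real.pi) ^ 2 := by
      have hab' : (a * Real.pi : ℂ) ^ 2 = (b * Real.pi : ℂ) ^ 2 := hab
      exact_mod_cast hab'
    have h2 := (sq_eq_sq₀ (by positivity) (by positivity)).1 h1
    exact_mod_cast mul_right_cancel₀ hpi.ne' h2
  unfold zeroCount
  rw [← finsum_mem_inter_support, hset, finsum_mem_coe_finset, Finset.sum_image hinj.injOn,
    Finset.sum_congr rfl fun k _ => analyticOrderNatAt_charFun_free k]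
  simp

/-! #### Counting eigenvalues -/

section
variable (hq : ContinuousOn L.q (Icc 0 1)) (hξ₀ : L.ξ₀ ∈ Icc (0 : ℝ) 1)
  (hξ₁ : L.ξ₁ ∈ Icc (0 : ℝ) 1)
include hq hξ₀ hξ₁

/-- Away from the zeros of the sine, `|ρ sin ρ|` is at least `|ρ| exp |Im ρ| / 4`, which beats the
bounded perturbation. This serves both Rouché's theorem and the exclusion of large negative
eigenvalues. -/
lemma exists_charFun_ne_zero : ∃ T : ℝ, ∀ ρ : ℂ, T ≤ ‖ρ‖ →
    Real.cos ρ.re ^ 2 ≤ 3 / 4 * Real.cosh ρ.im ^ 2 →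
    ‖L.charFun (ρ ^ 2) - ρ * Complex.sin ρ‖ < ‖ρ * Complex.sin ρ‖ := by
  obtain ⟨K, hK0, hK⟩ := exists_norm_charFun_sub_le hq hξ₀ hξ₁
  refine ⟨4 * K + 1, fun ρ hρ hcos => (hK ρ (by linarith)).trans_lt ?_⟩
  have h1 := exp_abs_le_norm_sin hcos
  rw [norm_mul]
  nlinarith [Real.exp_pos |ρ.im|]

lemma exists_zeroCount_charFun : ∃ N₀ : ℕ, ∀ N ≥ N₀,
    zeroCount L.charFun (((N + 1 / 2) * Real.pi) ^ 2) = N + 1 ∧ L.charFun ≠ 0 := by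
  obtain ⟨T, hT⟩ := exists_charFun_ne_zero hq hξ₀ hξ₁
  obtain ⟨N₀, hN₀⟩ := exists_nat_ge T
  refine ⟨N₀, fun N hN => ?_⟩
  have hR : (0 : ℝ) < ((N + 1 / 2) * Real.pi) ^ 2 := by positivity
  have hlt : ∀ z ∈ Metric.sphere (0 : ℂ) (((N + 1 / 2) * Real.pi) ^ 2),
      ‖L.charFun z - free.charFun z‖ < ‖free.charFun z‖ := by
    intro z hz
    obtain ⟨ρ, rfl⟩ := IsAlgClosed.exists_pow_nat_eq z two_pos
    rw [mem_sphere_zero_iff_norm, norm_pow, sq_eq_sq₀ (norm_nonneg _) (by positivity)] at hz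
    rw [charFun_free]
    refine hT ρ ?_ (cos_sq_le_of_norm_eq hz)
    rw [hz]
    have h1 : (N₀ : ℝ) ≤ N := by exact_mod_cast hN
    nlinarith [Real.pi_gt_three, (Nat.cast_nonneg N : (0 : ℝ) ≤ N)]
  refine ⟨?_, fun h0 => ?_⟩
  · rw [← zeroCount_charFun_free N]
    exact zeroCount_eq_of_norm_sub_lt (differentiable_charFun hq hξ₀ hξ₁)
      differentiable_charFun_free hR hlt
  · obtain ⟨w, hw⟩ : (Metric.sphere (0 : ℂ) (((N + 1 / 2) * Real.pi) ^ 2)).Nonempty :=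
      NormedSpace.sphere_nonempty.2 hR.le
    have := hlt w hw
    rw [h0] at this
    simp at this

/-- The eigenvalues can be listed. -/
theorem exists_isEigenvalueSequence : ∃ lam : ℕ → ℂ, L.IsEigenvalueSequence lam := by
  obtain ⟨N₀, hN₀⟩ := exists_zeroCount_charFun hq hξ₀ hξ₁
  obtain ⟨w, hw⟩ := Function.ne_iff.1 (hN₀ N₀ le_rfl).2
  obtain ⟨l, h1, h2⟩ := exists_zero_sequence (differentiable_charFun hq hξ₀ hξ₁) hw fun N => by
    refine ⟨(((max N N₀ : ℕ) + 1 / 2) * Real.pi) ^ 2, ?_⟩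
    rw [(hN₀ (max N N₀) (le_max_right _ _)).1]
    omega
  exact ⟨l, h1, h2⟩

end

/-- Sublevel sets of a monotone sequence are initial segments, so their size converts a count of
zeros into a statement about indices. -/
lemma lt_iff_lt_of_encard_eq {w : ℕ → ℝ} (hw : Monotone w) {R : ℝ} {k : ℕ}
    (h : {n | w n < R}.encard = k) (n : ℕ) : w n < R ↔ n < k := by
  constructor
  · intro hn
    have hsub : Iic n ⊆ {n | w n < R} := fun i hi => (hw hi).trans_lt hn
    have := encard_le_encard hsub
    rw [h, ← Finset.coe_Iic, encard_coe_eq_coe_finsetCard, Nat.card_Iic] at this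
    have : n + 1 ≤ k := by exact_mod_cast this
    omega
  · intro hn
    by_contra hcon
    have hsub : {n | w n < R} ⊆ Iio n := fun i (hi : w i < R) => by
      by_contra hin
      exact hcon ((hw (not_lt.1 hin)).trans_lt hi)
    have := encard_le_encard hsub
    rw [h, ← Finset.coe_Iio, encard_coe_eq_coe_finsetCard, Nat.card_Iio] at this
    have : k ≤ n := by exact_mod_cast this
    omega

/-- Large eigenvalues are positive and their square roots are close to `N π`. -/
theorem IsEigenvalueSequence.exists_sqrt (hq : ContinuousOn L.q (Icc 0 1))
    (hξ₀ : L.ξ₀ ∈ Icc (0 : ℝ) 1) (hξ₁ : L.ξ₁ ∈ Icc (0 : ℝ) 1) {lam : ℕ → ℂ}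
    (hlam : L.IsEigenvalueSequence lam) :
    ∃ K : ℝ, ∃ N₀ : ℕ, ∀ N ≥ N₀, ∃ ρ : ℝ, 1 ≤ ρ ∧ lam N = (ρ : ℂ) ^ 2 ∧
      L.charFun ((ρ : ℂ) ^ 2) = 0 ∧ ρ * |ρ - N * Real.pi| ≤ K := by
  have hpi := Real.pi_gt_three
  have hd := differentiable_charFun hq hξ₀ hξ₁
  obtain ⟨N₀, hN₀⟩ := exists_zeroCount_charFun hq hξ₀ hξ₁
  obtain ⟨w, hw⟩ := Function.ne_iff.1 (hN₀ N₀ le_rfl).2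
  obtain ⟨T, hT⟩ := exists_charFun_ne_zero hq hξ₀ hξ₁
  obtain ⟨N₁, hN₁⟩ := exists_nat_ge (max T 1)
  obtain ⟨K, hK0, hK⟩ := exists_norm_charFun_sub_le hq hξ₀ hξ₁
  have hiff (N : ℕ) (hN : N₀ ≤ N) (n : ℕ) :
      ‖lam n‖ < ((N + 1 / 2) * Real.pi) ^ 2 ↔ n < N + 1 := by
    refine lt_iff_lt_of_encard_eq hlam.mono ?_ n
    rw [encard_norm_lt_eq_zeroCount hd hw hlam.mult, (hN₀ N hN).1]
  have hzero (n : ℕ) : L.charFun (lam n) = 0 := by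
    rw [← (hd.analyticAt _).analyticOrderAt_ne_zero, ← hlam.mult]
    exact encard_ne_zero.2 ⟨n, rfl⟩
  -- The factor `π / 2` is from Jordan's inequality at the end; the margin `2` allows the circle
  -- number `N - 1` to be used too.
  refine ⟨Real.pi / 2 * K, N₀ + N₁ + 2, fun N hN => ?_⟩
  have hup : ‖lam N‖ < ((N + 1 / 2) * Real.pi) ^ 2 := (hiff N (by omega) N).2 (by omega)
  have hN1 : ((N - 1 : ℕ) : ℝ) = N - 1 := by
    rw [Nat.cast_sub (by omega), Nat.cast_one]
  have hhalf : (N : ℝ) - 1 + 1 / 2 = N - 1 / 2 := by ring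
  have hlo : ((N - 1 / 2) * Real.pi) ^ 2 ≤ ‖lam N‖ := by
    have := (hiff (N - 1) (by omega) N).not.2 (by omega)
    rw [hN1, hhalf] at this
    exact not_lt.1 this
  have hNr : (N₁ : ℝ) + 2 ≤ N := by
    have : N₁ + 2 ≤ N := by omega
    exact_mod_cast this
  have hN1' : T ≤ N₁ ∧ 1 ≤ (N₁ : ℝ) := ⟨(le_max_left _ _).trans hN₁, (le_max_right _ _).trans hN₁⟩
  have hbig : (N₁ : ℝ) ≤ (N - 1 / 2) * Real.pi := by nlinarith
  -- The conjugate is an eigenvalue of the same modulus, and `N` is the only index between the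
  -- circles `N - 1` and `N`.
  have hconj : (starRingEnd ℂ) (lam N) = lam N := by
    have h1 : L.charFun ((starRingEnd ℂ) (lam N)) = 0 := by
      rw [charFun_conj _ hq hξ₀ hξ₁, hzero, map_zero]
    have h2 : {n | lam n = (starRingEnd ℂ) (lam N)}.encard ≠ 0 := by
      rw [hlam.mult]
      exact (hd.analyticAt _).analyticOrderAt_ne_zero.2 h1
    obtain ⟨n, hn⟩ := encard_ne_zero.1 h2
    have hn' : ‖lam n‖ = ‖lam N‖ := by rw [show lam n = _ from hn, Complex.norm_conj]
    have h3 := (hiff N (by omega) n).1 (by rw [hn']; exact hup)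
    have h4 := (hiff (N - 1) (by omega) n).not.1 (by
      rwa [hn', hN1, hhalf, not_lt])
    have : n = N := by omega
    rw [← show lam n = _ from hn, this]
  obtain ⟨r, hr⟩ := Complex.conj_eq_iff_real.1 hconj
  rw [hr, Complex.norm_real, Real.norm_eq_abs] at hup hlo
  have hrT : (N₁ : ℝ) ≤ √|r| := Real.le_sqrt_of_sq_le (le_trans (by gcongr) hlo)
  -- A nonpositive eigenvalue is `(i t)²` with `t ≥ 1`; there the comparison with `ρ sin ρ` holds
  -- strictly and forbids a zero.
  have hrpos : 0 < r := by
    by_contra hneg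
    have habs : |r| = -r := abs_of_nonpos (not_lt.1 hneg)
    set t := √|r| with ht
    have ht2 : t ^ 2 = -r := by rw [ht, Real.sq_sqrt (abs_nonneg _), habs]
    have hsq : ((t : ℂ) * Complex.I) ^ 2 = lam N := by
      rw [mul_pow, Complex.I_sq, hr, ← Complex.ofReal_pow, ht2]
      push_cast; ring
    have h1 := hT ((t : ℂ) * Complex.I) (by
      rw [norm_mul, Complex.norm_I, Complex.norm_real, mul_one]
      exact (hN1'.1.trans hrT).trans (le_abs_self _)) (by
      have := one_add_sq_le_cosh_sq t
      have h2 : Real.cos ((t : ℂ) * Complex.I).re ^ 2 ≤ 1 := Real.cos_sq_le_one _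
      simp only [Complex.mul_im, Complex.ofReal_re, Complex.I_im, Complex.ofReal_im, Complex.I_re]
      rw [mul_one, zero_mul, add_zero]
      nlinarith)
    rw [hsq, hzero, zero_sub, norm_neg] at h1
    exact lt_irrefl _ h1
  rw [abs_of_pos hrpos] at hup hlo hrT
  set ρ := √r with hρ
  have hρ2 : ρ ^ 2 = r := Real.sq_sqrt hrpos.le
  have hρ0 : 0 < ρ := Real.sqrt_pos.2 hrpos
  have heq : lam N = (ρ : ℂ) ^ 2 := by rw [hr, ← hρ2]; push_cast; rfl
  have hz : L.charFun ((ρ : ℂ) ^ 2) = 0 := by rw [← heq, hzero]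
  refine ⟨ρ, hN1'.2.trans hrT, heq, hz, ?_⟩
  rw [← hρ2] at hup hlo
  have hup' := (sq_lt_sq₀ hρ0.le (by positivity)).1 hup
  have hlo' := (sq_le_sq₀ (by linarith) hρ0.le).1 hlo
  have h1 := hK ρ (by
    rw [Complex.norm_real, Real.norm_of_nonneg hρ0.le]
    linarith)
  rw [hz, zero_sub, norm_neg, Complex.ofReal_im, abs_zero, Real.exp_zero, mul_one, norm_mul,
    ← Complex.ofReal_sin, Complex.norm_real, Complex.norm_real, Real.norm_of_nonneg hρ0.le,
    Real.norm_eq_abs] at h1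
  have h2 : |ρ - N * Real.pi| ≤ Real.pi / 2 := by
    rw [abs_le]; constructor <;> linarith
  have h3 := Real.mul_abs_le_abs_sin h2
  rw [Real.sin_sub_nat_mul_pi, abs_mul, abs_pow, abs_neg, abs_one, one_pow, one_mul] at h3
  have h4 : |ρ - N * Real.pi| ≤ Real.pi / 2 * |Real.sin ρ| := by
    calc |ρ - N * Real.pi| = Real.pi / 2 * (2 / Real.pi * |ρ - N * Real.pi|) := by
          field_simp
      _ ≤ _ := by gcongr
  calc ρ * |ρ - N * Real.pi| ≤ ρ * (Real.pi / 2 * |Real.sin ρ|) := by gcongr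
    _ = Real.pi / 2 * (ρ * |Real.sin ρ|) := by ring
    _ ≤ _ := by gcongr

end NonlocalSL

/-! ### The Prüfer angle -/

namespace NonlocalSL

variable {L : NonlocalSL}

/-- `θ` is a Prüfer angle for the equation `-y'' + q y = ρ² y` on `[0,1]`. -/
def IsPrufer (L : NonlocalSL) (ρ : ℝ) (θ : ℝ → ℝ) : Prop :=
  ∀ x ∈ Icc (0 : ℝ) 1, HasDerivWithinAt θ (ρ - L.q x / ρ * Real.cos (θ x) ^ 2) (Icc 0 1) x

lemma abs_cos_sq_sub_cos_sq_le (a b : ℝ) : |Real.cos a ^ 2 - Real.cos b ^ 2| ≤ |a - b| := by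
  have h : Real.cos a ^ 2 - Real.cos b ^ 2 = -(Real.sin (a + b) * Real.sin (a - b)) := by
    rw [Real.sin_add, Real.sin_sub]
    nlinarith [Real.sin_sq_add_cos_sq a, Real.sin_sq_add_cos_sq b]
  rw [h, abs_neg, abs_mul]
  exact (mul_le_mul (Real.abs_sin_le_one _) Real.abs_sin_le_abs (abs_nonneg _)
    zero_le_one).trans_eq (one_mul _)

/-- The right-hand side is bounded and Lipschitz in the angle globally, so one Picard–Lindelöf step
covers all of `[0,1]`. -/
lemma exists_isPrufer (hq : ContinuousOn L.q (Icc 0 1)) {ρ : ℝ} (hρ : 0 < ρ) (θ₀ : ℝ) :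
    ∃ θ : ℝ → ℝ, θ 0 = θ₀ ∧ L.IsPrufer ρ θ := by
  obtain ⟨B, hB0, hB⟩ := exists_abs_q_le hq
  have hbd : ∀ t ∈ Icc (0 : ℝ) 1, |L.q t / ρ| ≤ B / ρ := by
    intro t ht
    rw [abs_div, abs_of_pos hρ]
    gcongr
    exact hB t ht
  have hPL : IsPicardLindelof (fun t θ => ρ - L.q t / ρ * Real.cos θ ^ 2)
      (tmin := 0) (tmax := 1) (⟨0, by simp⟩ : Icc (0 : ℝ) 1) θ₀ (ρ + B / ρ).toNNReal 0
      (ρ + B / ρ).toNNReal (B / ρ).toNNReal := by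
    refine ⟨fun t ht => ?_, fun θ _ => ?_, fun t ht θ _ => ?_, ?_⟩
    · refine LipschitzOnWith.of_dist_le_mul fun a _ b _ => ?_
      rw [Real.coe_toNNReal _ (by positivity), Real.dist_eq, Real.dist_eq]
      have : ρ - L.q t / ρ * Real.cos a ^ 2 - (ρ - L.q t / ρ * Real.cos b ^ 2) =
          -(L.q t / ρ * (Real.cos a ^ 2 - Real.cos b ^ 2)) := by ring
      rw [this, abs_neg, abs_mul]
      exact mul_le_mul (hbd t ht) (abs_cos_sq_sub_cos_sq_le a b) (abs_nonneg _) (by positivity)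
    · exact continuousOn_const.sub ((hq.div_const ρ).mul continuousOn_const)
    · rw [Real.coe_toNNReal _ (by positivity), Real.norm_eq_abs]
      refine (abs_sub _ _).trans ?_
      rw [abs_of_pos hρ, abs_mul, abs_of_nonneg (sq_nonneg (Real.cos θ))]
      gcongr
      calc |L.q t / ρ| * Real.cos θ ^ 2 ≤ B / ρ * 1 := by
            gcongr
            · exact hbd t ht
            · exact Real.cos_sq_le_one θ
        _ = _ := mul_one _
    · simp
  exact hPL.exists_eq_forall_mem_Icc_hasDerivWithinAt₀

lemma IsPrufer.continuousOn {ρ : ℝ} {θ : ℝ → ℝ} (h : L.IsPrufer ρ θ) :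
    ContinuousOn θ (Icc 0 1) := fun x hx => (h x hx).continuousWithinAt

lemma IsPrufer.strictMonoOn {ρ : ℝ} {θ : ℝ → ℝ} (h : L.IsPrufer ρ θ) {B : ℝ}
    (hB : ∀ x ∈ Icc (0 : ℝ) 1, |L.q x| ≤ B) (hρ : 0 < ρ) (hBρ : B < ρ ^ 2) :
    StrictMonoOn θ (Icc 0 1) := by
  refine strictMonoOn_of_hasDerivWithinAt_pos (convex_Icc 0 1) h.continuousOn
    (fun x hx => (h x (interior_subset hx)).mono interior_subset) fun x hx => ?_
  have h1 := (abs_le.1 (hB x (interior_subset hx))).2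
  have h2 := Real.cos_sq_le_one (θ x)
  have h3 : L.q x * Real.cos (θ x) ^ 2 < ρ ^ 2 := by
    have hB0 := (abs_nonneg _).trans (hB x (interior_subset hx))
    nlinarith [sq_nonneg (Real.cos (θ x))]
  have h4 : ρ - L.q x / ρ * Real.cos (θ x) ^ 2 = (ρ ^ 2 - L.q x * Real.cos (θ x) ^ 2) / ρ := by
    field_simp
  rw [h4]
  exact div_pos (by linarith) hρ

lemma hasDerivWithinAt_ofReal {f : ℝ → ℝ} {f' x : ℝ} {s : Set ℝ} (h : HasDerivWithinAt f f' s x) :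
    HasDerivWithinAt (fun t => (f t : ℂ)) (f' : ℂ) s x := h.ofReal_comp

/-- A solution whose initial data are aligned with the Prüfer angle stays aligned with it. -/
lemma IsPrufer.aligned (hq : ContinuousOn L.q (Icc 0 1)) {ρ : ℝ} {θ : ℝ → ℝ}
    (h : L.IsPrufer ρ θ) (hρ : 0 < ρ) {y : ℝ → ℂ} (hy : L.IsSolution ((ρ : ℂ) ^ 2) y)
    (h0 : ρ * y 0 * (Real.sin (θ 0) : ℝ) + D y 0 * (Real.cos (θ 0) : ℝ) = 0) {x : ℝ}
    (hx : x ∈ Icc (0 : ℝ) 1) :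
    ρ * y x * (Real.sin (θ x) : ℝ) + D y x * (Real.cos (θ x) : ℝ) = 0 := by
  obtain ⟨B, hB0, hB⟩ := exists_abs_q_le hq
  set W : ℝ → ℂ := fun x => ρ * y x * (Real.sin (θ x) : ℝ) + D y x * (Real.cos (θ x) : ℝ) with hW
  -- The Prüfer equation is what makes the misalignment `W` solve a homogeneous linear equation;
  -- Grönwall for `‖W‖²` keeps it zero.
  have hd : ∀ x ∈ Icc (0 : ℝ) 1, HasDerivWithinAt W
      ((L.q x / ρ * Real.sin (θ x) * Real.cos (θ x)) • W x) (Icc 0 1) x := by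
    intro x hx
    have hs := hasDerivWithinAt_ofReal (h x hx).sin
    have hc := hasDerivWithinAt_ofReal (h x hx).cos
    refine ((((hy.hasDeriv hx).const_mul (ρ : ℂ)).mul hs).add
      ((hy.hasDeriv_D hx).mul hc)).congr_deriv ?_
    have hρ' : (ρ : ℂ) ≠ 0 := by exact_mod_cast hρ.ne'
    have hsc : (Real.sin (θ x) : ℂ) ^ 2 = 1 - (Real.cos (θ x) : ℂ) ^ 2 := by
      have := Real.sin_sq (θ x)
      exact_mod_cast this
    rw [Complex.real_smul, hW]
    push_cast at hsc ⊢
    field_simp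
    linear_combination (-(ρ * y x * Complex.cos (θ x) * L.q x)) * hsc
  have hu : ∀ x ∈ Icc (0 : ℝ) 1, HasDerivWithinAt (fun t => ‖W t‖ ^ 2)
      (2 * (L.q x / ρ * Real.sin (θ x) * Real.cos (θ x)) * ‖W x‖ ^ 2) (Icc 0 1) x := by
    intro x hx
    refine (hd x hx).norm_sq.congr_deriv ?_
    rw [real_inner_smul_right, real_inner_self_eq_norm_sq]
    ring
  have hK : ∀ x ∈ Icc (0 : ℝ) 1,
      |2 * (L.q x / ρ * Real.sin (θ x) * Real.cos (θ x)) * ‖W x‖ ^ 2| ≤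
        2 * (B / ρ * 1 * 1) * ‖W x‖ ^ 2 := by
    intro x hx
    rw [abs_mul, abs_mul, abs_mul, abs_mul, abs_two, abs_of_nonneg (sq_nonneg ‖W x‖), abs_div,
      abs_of_pos hρ]
    gcongr
    · exact hB x hx
    · exact Real.abs_sin_le_one _
    · exact Real.abs_cos_le_one _
  have := le_mul_exp_of_abs_deriv_le hu hK hx zero_mem
  rw [show W 0 = 0 from h0, norm_zero, zero_pow two_ne_zero, zero_mul] at this
  have h2 : ‖W x‖ ^ 2 = 0 := le_antisymm this (sq_nonneg _)
  exact norm_eq_zero.1 (pow_eq_zero_iff two_ne_zero |>.1 h2)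

lemma IsPrufer.zero_iff (hq : ContinuousOn L.q (Icc 0 1)) {ρ : ℝ} {θ : ℝ → ℝ}
    (h : L.IsPrufer ρ θ) (hρ : 0 < ρ) {y : ℝ → ℂ} (hy : L.IsSolution ((ρ : ℂ) ^ 2) y)
    (h0 : ρ * y 0 * (Real.sin (θ 0) : ℝ) + D y 0 * (Real.cos (θ 0) : ℝ) = 0) (hne : y 0 ≠ 0)
    {x : ℝ} (hx : x ∈ Icc (0 : ℝ) 1) : y x = 0 ↔ Real.cos (θ x) = 0 := by
  have hal := h.aligned hq hρ hy h0 hx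
  constructor
  · intro hyx
    rw [hyx, mul_zero, zero_mul, zero_add] at hal
    rcases mul_eq_zero.1 hal with hD | hc
    · exact absurd (hy.eq_zero hq hx hyx hD zero_mem).1 hne
    · exact_mod_cast hc
  · intro hc
    rw [hc, Complex.ofReal_zero, mul_zero, add_zero] at hal
    have hs : (Real.sin (θ x) : ℂ) ≠ 0 := by
      intro hs
      have hs' : Real.sin (θ x) = 0 := by exact_mod_cast hs
      have := Real.sin_sq_add_cos_sq (θ x)
      rw [hs', hc] at this
      norm_num at this
    have hρ' : (ρ : ℂ) ≠ 0 := by exact_mod_cast hρ.ne'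
    exact (mul_eq_zero.1 ((mul_eq_zero.1 hal).resolve_right hs)).resolve_left hρ'

/-- The second order expansion of the Prüfer angle. -/
lemma exists_prufer_expansion (hq : ContDiffOn ℝ 1 L.q (Icc 0 1)) {Q : ℝ → ℝ}
    (hQ : ∀ x ∈ Icc (0 : ℝ) 1, HasDerivWithinAt Q (L.q x) (Icc 0 1) x) (hQ0 : Q 0 = 0) :
    ∃ K : ℝ, 0 ≤ K ∧ ∀ ρ : ℝ, 1 ≤ ρ → ∀ θ, L.IsPrufer ρ θ → ∀ x ∈ Icc (0 : ℝ) 1,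
      |θ x - θ 0 - ρ * x + Q x / (2 * ρ)| ≤ K / ρ ^ 2 := by
  obtain ⟨B, hB0, hB⟩ := exists_abs_q_le hq.continuousOn
  obtain ⟨B', hB'⟩ := isCompact_Icc.exists_bound_of_continuousOn
    (hq.continuousOn_derivWithin uniqueDiffOn_Icc_zero_one le_rfl)
  have hB'0 : 0 ≤ B' := (norm_nonneg _).trans (hB' 0 zero_mem)
  have hqd : ∀ x ∈ Icc (0 : ℝ) 1, HasDerivWithinAt L.q (derivWithin L.q (Icc 0 1) x) (Icc 0 1) x :=
    fun x hx => (hq.differentiableOn one_ne_zero x hx).hasDerivWithinAt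
  refine ⟨B' + B ^ 2 + B, by positivity, fun ρ hρ θ hθ x hx => ?_⟩
  have hρ0 : 0 < ρ := by linarith
  -- The last summand performs the integration by parts: its derivative cancels `q cos 2θ / (2ρ)`
  -- and leaves only terms of order `ρ⁻²`.
  set G : ℝ → ℝ := fun x => θ x - ρ * x + (2 * ρ)⁻¹ * Q x +
    (4 * ρ ^ 2)⁻¹ * (L.q x * Real.sin (2 * θ x)) with hG
  set q' := fun x => derivWithin L.q (Icc 0 1) x
  have hd : ∀ x ∈ Icc (0 : ℝ) 1, HasDerivWithinAt G ((4 * ρ ^ 2)⁻¹ * (q' x * Real.sin (2 * θ x)) -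
      (2 * ρ ^ 3)⁻¹ * (L.q x ^ 2 * Real.cos (2 * θ x) * Real.cos (θ x) ^ 2)) (Icc 0 1) x := by
    intro x hx
    have h1 := hθ x hx
    refine (((h1.sub ((hasDerivWithinAt_id x _).const_mul ρ)).add ((hQ x hx).const_mul _)).add
      (((hqd x hx).mul (h1.const_mul 2).sin).const_mul _)).congr_deriv ?_
    have h2 := Real.cos_two_mul (θ x)
    rw [h2]
    field_simp
    ring
  have hbd : ∀ x ∈ Icc (0 : ℝ) 1, ‖(4 * ρ ^ 2)⁻¹ * (q' x * Real.sin (2 * θ x)) -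
      (2 * ρ ^ 3)⁻¹ * (L.q x ^ 2 * Real.cos (2 * θ x) * Real.cos (θ x) ^ 2)‖ ≤
      (B' + B ^ 2) / ρ ^ 2 := by
    intro x hx
    have h1 : |q' x * Real.sin (2 * θ x)| ≤ B' := by
      rw [abs_mul]
      have := hB' x hx
      have h2 := Real.abs_sin_le_one (2 * θ x)
      calc |q' x| * |Real.sin (2 * θ x)| ≤ B' * 1 := by gcongr; exact this
        _ = B' := mul_one _
    have h2 : |L.q x ^ 2 * Real.cos (2 * θ x) * Real.cos (θ x) ^ 2| ≤ B ^ 2 := by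
      rw [abs_mul, abs_mul, abs_pow, abs_pow]
      have h3 := hB x hx
      calc |L.q x| ^ 2 * |Real.cos (2 * θ x)| * |Real.cos (θ x)| ^ 2 ≤ B ^ 2 * 1 * 1 ^ 2 := by
            gcongr
            · exact Real.abs_cos_le_one _
            · exact Real.abs_cos_le_one _
        _ = B ^ 2 := by ring
    have h3 : (4 * ρ ^ 2)⁻¹ ≤ (ρ ^ 2)⁻¹ := by
      apply inv_anti₀ (by positivity); nlinarith
    have h4 : (2 * ρ ^ 3)⁻¹ ≤ (ρ ^ 2)⁻¹ := by
      apply inv_anti₀ (by positivity); nlinarith [sq_nonneg ρ]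
    rw [Real.norm_eq_abs]
    refine (abs_sub _ _).trans ?_
    rw [abs_mul (4 * ρ ^ 2)⁻¹, abs_mul (2 * ρ ^ 3)⁻¹,
      abs_of_pos (a := (4 * ρ ^ 2)⁻¹) (by positivity), abs_of_pos (a := (2 * ρ ^ 3)⁻¹) (by positivity)]
    calc _ ≤ (ρ ^ 2)⁻¹ * B' + (ρ ^ 2)⁻¹ * B ^ 2 := by gcongr
      _ = _ := by field_simp
  have hmain := Convex.norm_image_sub_le_of_norm_hasDerivWithin_le hd hbd (convex_Icc 0 1)
    zero_mem hx
  have hx1 : ‖x - 0‖ ≤ 1 := by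
    rw [sub_zero, Real.norm_of_nonneg hx.1]; exact hx.2
  have hmain' : |G x - G 0| ≤ (B' + B ^ 2) / ρ ^ 2 :=
    hmain.trans (mul_le_of_le_one_right (by positivity) hx1)
  have hE (x : ℝ) (hx : x ∈ Icc (0 : ℝ) 1) :
      |(4 * ρ ^ 2)⁻¹ * (L.q x * Real.sin (2 * θ x))| ≤ B / 2 / ρ ^ 2 := by
    rw [abs_mul, abs_of_pos (a := (4 * ρ ^ 2)⁻¹) (by positivity), abs_mul]
    calc (4 * ρ ^ 2)⁻¹ * (|L.q x| * |Real.sin (2 * θ x)|) ≤ (2 * ρ ^ 2)⁻¹ * (B * 1) := by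
          gcongr
          · norm_num
          · exact hB x hx
          · exact Real.abs_sin_le_one _
      _ = _ := by field_simp
  have e : θ x - θ 0 - ρ * x + Q x / (2 * ρ) = (G x - G 0) -
      (4 * ρ ^ 2)⁻¹ * (L.q x * Real.sin (2 * θ x)) +
      (4 * ρ ^ 2)⁻¹ * (L.q 0 * Real.sin (2 * θ 0)) := by
    rw [hG]
    simp only [hQ0]
    ring
  rw [e]
  refine (abs_add_le _ _).trans ((add_le_add_left (abs_sub _ _) _).trans ?_)
  calc _ ≤ (B' + B ^ 2) / ρ ^ 2 + B / 2 / ρ ^ 2 + B / 2 / ρ ^ 2 := by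
        gcongr
        · exact hE x hx
        · exact hE 0 zero_mem
    _ = _ := by ring

/-! #### Counting zeros -/

/-- The phase maps these zeros bijectively onto the levels `(i + 1/2) π` with `i < k`; the bound on
`θ 0` makes `i = 0` the first level crossed. -/
lemma encard_zeros {θ : ℝ → ℝ} (hc : ContinuousOn θ (Icc 0 1)) (hm : StrictMonoOn θ (Icc 0 1))
    (h0 : |θ 0| < Real.pi / 2) {t : ℝ} (ht : t ∈ Ioo (0 : ℝ) 1) {k : ℕ}
    (hk : θ t = (k + 1 / 2) * Real.pi) :
    {s : ℝ | s ∈ Ioo (0 : ℝ) t ∧ Real.cos (θ s) = 0}.encard = k := by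
  have hpi := Real.pi_pos
  have hsub : Ioo (0 : ℝ) t ⊆ Icc 0 1 := fun s hs => ⟨hs.1.le, (hs.2.trans ht.2).le⟩
  have htI : t ∈ Icc (0 : ℝ) 1 := Ioo_subset_Icc_self ht
  rw [abs_lt] at h0
  have himage : θ '' {s : ℝ | s ∈ Ioo (0 : ℝ) t ∧ Real.cos (θ s) = 0} =
      (fun i : ℕ => ((i : ℝ) + 1 / 2) * Real.pi) '' Iio k := by
    ext v
    constructor
    · rintro ⟨s, ⟨hs, hcos⟩, rfl⟩
      obtain ⟨i, hi⟩ := Real.cos_eq_zero_iff.1 hcos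
      have h1 := hm zero_mem (hsub hs) hs.1
      have h2 := hm (hsub hs) htI hs.2
      rw [hi] at h1 h2
      rw [hk] at h2
      have hi0 : (-1 : ℝ) < i := by
        have : (-1 : ℝ) * Real.pi < i * Real.pi := by linarith
        exact lt_of_mul_lt_mul_right this hpi.le
      have hik : (i : ℝ) < k := by
        have : (i : ℝ) * Real.pi < k * Real.pi := by linarith
        exact lt_of_mul_lt_mul_right this hpi.le
      have hi0' : (-1 : ℤ) < i := by exact_mod_cast hi0
      obtain ⟨n, rfl⟩ := Int.eq_ofNat_of_zero_le (show (0 : ℤ) ≤ i by omega)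
      refine ⟨n, by exact_mod_cast hik, ?_⟩
      simp only [hi]
      push_cast
      ring
    · rintro ⟨i, hi, rfl⟩
      have hi' : (i : ℝ) < k := by exact_mod_cast hi
      have hmem : ((i : ℝ) + 1 / 2) * Real.pi ∈ Ioo (θ 0) (θ t) := by
        rw [hk]
        constructor <;> nlinarith [(Nat.cast_nonneg i : (0 : ℝ) ≤ i)]
      obtain ⟨s, hs, hsv⟩ := intermediate_value_Ioo ht.1.le
        (hc.mono (Icc_subset_Icc_right ht.2.le)) hmem
      refine ⟨s, ⟨hs, ?_⟩, hsv⟩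
      rw [hsv]
      exact cos_nat_add_half_mul_pi i
  have hinj1 : InjOn θ {s : ℝ | s ∈ Ioo (0 : ℝ) t ∧ Real.cos (θ s) = 0} :=
    hm.injOn.mono fun s hs => hsub hs.1
  have hinj2 : Function.Injective fun i : ℕ => ((i : ℝ) + 1 / 2) * Real.pi := by
    intro a b hab
    have := mul_right_cancel₀ hpi.ne' hab
    exact_mod_cast add_right_cancel this
  rw [← hinj1.encard_image, himage, hinj2.encard_image, ← Finset.coe_Iio,
    encard_coe_eq_coe_finsetCard, Nat.card_Iio]

lemma exists_nat_of_cos_eq_zero {θ : ℝ → ℝ} (hm : StrictMonoOn θ (Icc 0 1))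
    (h0 : |θ 0| < Real.pi / 2) {t : ℝ} (ht : t ∈ Ioo (0 : ℝ) 1) (hcos : Real.cos (θ t) = 0) :
    ∃ k : ℕ, θ t = (k + 1 / 2) * Real.pi := by
  have hpi := Real.pi_pos
  obtain ⟨i, hi⟩ := Real.cos_eq_zero_iff.1 hcos
  have h1 := hm zero_mem (Ioo_subset_Icc_self ht) ht.1
  rw [abs_lt] at h0
  have hi0 : (-1 : ℝ) < i := by
    have : (-1 : ℝ) * Real.pi < i * Real.pi := by linarith
    exact lt_of_mul_lt_mul_right this hpi.le
  have hi0' : (-1 : ℤ) < i := by exact_mod_cast hi0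
  obtain ⟨n, rfl⟩ := Int.eq_ofNat_of_zero_le (show (0 : ℤ) ≤ i by omega)
  refine ⟨n, ?_⟩
  rw [hi]
  push_cast
  ring

end NonlocalSL

/-! ### Asymptotics of eigenfunctions -/

namespace NonlocalSL

variable {L : NonlocalSL}

/-- Variation of constants again: `y' sin(ρ(x-t)) + ρ y cos(ρ(x-t))` equals `ρ y(x)` at `t = x` and
has derivative `q y sin(ρ(x-t))`, bounded for real `ρ`. -/
lemma exists_norm_sub_cos_le (hq : ContinuousOn L.q (Icc 0 1)) :
    ∃ K : ℝ, 0 ≤ K ∧ ∀ ρ : ℝ, 1 ≤ ρ → ∀ y, L.IsSolution ((ρ : ℂ) ^ 2) y → ∀ x ∈ Icc (0 : ℝ) 1,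
      ‖y x - y 0 * (Real.cos (ρ * x) : ℝ)‖ ≤ K * (‖y 0‖ + ‖D y 0‖) / ρ := by
  obtain ⟨B, hB0, hB⟩ := exists_abs_q_le hq
  refine ⟨1 + B * Real.exp B, by positivity, fun ρ hρ y hy x hx => ?_⟩
  have hρ0 : 0 < ρ := by linarith
  have hnρ : ‖(ρ : ℂ)‖ = ρ := by rw [Complex.norm_real, Real.norm_of_nonneg hρ0.le]
  set E := ‖y 0‖ + ‖D y 0‖ with hE
  have hyb : ∀ t ∈ Icc (0 : ℝ) 1, ‖y t‖ ≤ E * Real.exp B := by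
    intro t ht
    have h1 := (hy.sqrt_energy_le hB (hρ.trans_eq hnρ.symm) ht zero_mem).1
    rw [hnρ, Complex.ofReal_im, abs_zero, zero_mul, Real.exp_zero, mul_one] at h1
    have h2 : ρ * ‖y t‖ ≤ ρ * (E * Real.exp B) := by
      refine h1.trans ?_
      rw [← mul_assoc]
      gcongr
      rw [hE]
      nlinarith [norm_nonneg (D y 0)]
    exact le_of_mul_le_mul_left h2 hρ0
  have hd : ∀ t ∈ Icc (0 : ℝ) 1, HasDerivWithinAt
      (fun t : ℝ => D y t * Complex.sin (ρ * ((x : ℂ) - t)) +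
        ρ * (y t * Complex.cos (ρ * ((x : ℂ) - t))))
      (L.q t * y t * Complex.sin (ρ * ((x : ℂ) - t))) (Icc 0 1) t := fun t ht => by
    have h0 := hasDerivAt_mul_one_sub ρ x t
    exact (((hy.hasDeriv_D ht).mul h0.csin_real.hasDerivWithinAt).add
      (((hy.hasDeriv ht).mul h0.ccos_real.hasDerivWithinAt).const_mul _)).congr_deriv (by ring)
  have hb : ∀ t ∈ Icc (0 : ℝ) 1, ‖(L.q t : ℂ) * y t * Complex.sin (ρ * ((x : ℂ) - t))‖ ≤
      B * (E * Real.exp B) * 1 := by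
    intro t ht
    have h1 : ‖Complex.sin (ρ * ((x : ℂ) - t))‖ ≤ 1 := by
      rw [← Complex.ofReal_sub, ← Complex.ofReal_mul, ← Complex.ofReal_sin, Complex.norm_real]
      exact Real.abs_sin_le_one _
    have h2 : ‖L.q t‖ ≤ B := hB t ht
    have h3 := hyb t ht
    rw [norm_mul, norm_mul, Complex.norm_real]
    gcongr
  have hmain := Convex.norm_image_sub_le_of_norm_hasDerivWithin_le hd hb (convex_Icc 0 1)
    zero_mem hx
  have hx1 : ‖x - 0‖ ≤ 1 := by
    rw [sub_zero, Real.norm_of_nonneg hx.1]; exact hx.2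
  have hmain' := hmain.trans (mul_le_of_le_one_right (by positivity) hx1)
  simp only [sub_self, mul_zero, Complex.sin_zero, Complex.cos_zero, zero_add, mul_one,
    Complex.ofReal_zero, sub_zero] at hmain'
  have hs : ‖D y 0 * Complex.sin (ρ * x)‖ ≤ E := by
    rw [norm_mul, ← Complex.ofReal_mul, ← Complex.ofReal_sin, Complex.norm_real]
    calc ‖D y 0‖ * ‖Real.sin (ρ * x)‖ ≤ ‖D y 0‖ * 1 := by
          gcongr; exact Real.abs_sin_le_one _
      _ ≤ E := by rw [hE]; linarith [norm_nonneg (y 0)]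
  rw [le_div_iff₀ hρ0]
  calc ‖y x - y 0 * (Real.cos (ρ * x) : ℝ)‖ * ρ
      = ‖(ρ * y x - (D y 0 * Complex.sin (ρ * x) + ρ * (y 0 * Complex.cos (ρ * x)))) +
          D y 0 * Complex.sin (ρ * x)‖ := by
        nth_rewrite 2 [← hnρ]
        rw [← norm_mul]
        push_cast
        ring_nf
    _ ≤ B * (E * Real.exp B) + E := (norm_add_le _ _).trans (add_le_add hmain' hs)
    _ = _ := by ring

/-- The ratio `y'(0) / y(0)` for solutions satisfying the left boundary condition. -/
def ratio (L : NonlocalSL) (ρ : ℝ) : ℝ :=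
  -(L.h - L.γ₀ * (L.C ((ρ : ℂ) ^ 2) L.ξ₀).re) / (1 - L.γ₀ * (L.S ((ρ : ℂ) ^ 2) L.ξ₀).re)

section
variable (hq : ContinuousOn L.q (Icc 0 1)) (hξ₀ : L.ξ₀ ∈ Icc (0 : ℝ) 1) {ρ : ℝ}
  (hS : 1 - L.γ₀ * (L.S ((ρ : ℂ) ^ 2) L.ξ₀).re ≠ 0)
include hq

lemma C_S_real {x : ℝ} (hx : x ∈ Icc (0 : ℝ) 1) :
    L.C ((ρ : ℂ) ^ 2) x = ((L.C ((ρ : ℂ) ^ 2) x).re : ℝ) ∧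
      L.S ((ρ : ℂ) ^ 2) x = ((L.S ((ρ : ℂ) ^ 2) x).re : ℝ) := by
  have h1 := (C_conj ((ρ : ℂ) ^ 2) hq hx).1
  have h2 := (S_conj ((ρ : ℂ) ^ 2) hq hx).1
  rw [map_pow, Complex.conj_ofReal] at h1 h2
  exact ⟨(Complex.conj_eq_iff_re.1 h1.symm).symm, (Complex.conj_eq_iff_re.1 h2.symm).symm⟩

include hξ₀ hS

lemma ratio_mul : (L.ratio ρ : ℂ) * (1 - L.γ₀ * L.S ((ρ : ℂ) ^ 2) L.ξ₀) =
    -(L.h - L.γ₀ * L.C ((ρ : ℂ) ^ 2) L.ξ₀) := by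
  rw [(C_S_real hq hξ₀).1, (C_S_real hq hξ₀).2]
  have : L.ratio ρ * (1 - L.γ₀ * (L.S ((ρ : ℂ) ^ 2) L.ξ₀).re) =
      -(L.h - L.γ₀ * (L.C ((ρ : ℂ) ^ 2) L.ξ₀).re) := div_mul_cancel₀ _ hS
  exact_mod_cast this

lemma one_sub_ne_zero : (1 - L.γ₀ * L.S ((ρ : ℂ) ^ 2) L.ξ₀) ≠ 0 := by
  rw [(C_S_real hq hξ₀).2]
  exact_mod_cast hS

lemma IsEigenfunction.D_zero_eq {y : ℝ → ℂ} (hy : L.IsEigenfunction ((ρ : ℂ) ^ 2) y) :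
    D y 0 = L.ratio ρ * y 0 ∧ y 0 ≠ 0 := by
  have h1 := hy.left
  rw [U, (hy.sol.eq_C_S hq hξ₀).1] at h1
  have h2 : D y 0 = L.ratio ρ * y 0 := by
    refine mul_right_cancel₀ (one_sub_ne_zero hq hξ₀ hS) ?_
    linear_combination h1 - y 0 * ratio_mul hq hξ₀ hS
  refine ⟨h2, fun h0 => ?_⟩
  obtain ⟨x, hx, hne⟩ := hy.nontrivial
  exact hne (hy.sol.eq_zero hq zero_mem h0 (by rw [h2, h0, mul_zero]) hx).1

/-- The ratio is chosen so that `C + ratio * S` satisfies the left condition. Multiplied by the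
nonzero `U(S)`, the right condition is then the vanishing of the determinant. -/
lemma exists_isEigenfunction (h0 : L.charFun ((ρ : ℂ) ^ 2) = 0) :
    ∃ y, L.IsEigenfunction ((ρ : ℂ) ^ 2) y ∧ y 0 = 1 ∧ D y 0 = L.ratio ρ := by
  obtain ⟨c1, c2, c3⟩ := C_spec ((ρ : ℂ) ^ 2) hq
  obtain ⟨s1, s2, s3⟩ := S_spec ((ρ : ℂ) ^ 2) hq
  have hr := ratio_mul hq hξ₀ hS
  refine ⟨_, ⟨c1.add_mul s1 1 (L.ratio ρ), ?_, ?_, 0, zero_mem, ?_⟩, ?_, ?_⟩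
  · rw [U, D_add_mul c1 s1 _ _ zero_mem, c2, c3, s2, s3]
    linear_combination hr
  · rw [V, D_add_mul c1 s1 _ _ one_mem]
    rw [charFun_eq hq] at h0
    refine (mul_eq_zero.1 (?_ : (1 - L.γ₀ * L.S ((ρ : ℂ) ^ 2) L.ξ₀) * _ = 0)).resolve_left
      (one_sub_ne_zero hq hξ₀ hS)
    linear_combination -h0 + (D (L.S ((ρ : ℂ) ^ 2)) 1 + L.H * L.S ((ρ : ℂ) ^ 2) 1 -
      L.γ₁ * L.S ((ρ : ℂ) ^ 2) L.ξ₁) * hr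
  · rw [c2, s2]; simp
  · rw [c2, s2]; ring
  · rw [D_add_mul c1 s1 _ _ zero_mem, c3, s3]; ring

end

/-! #### Limits along the arithmetic progression -/

lemma tendsto_mul_comp {g : ℝ → ℝ} (hg0 : g 0 = 0) (hg : HasDerivAt g 1 0) {r u : ℕ → ℝ} {ℓ : ℝ}
    (hu : Tendsto u atTop (𝓝 0)) (hru : Tendsto (fun n => r n * u n) atTop (𝓝 ℓ)) :
    Tendsto (fun n => r n * g (u n)) atTop (𝓝 ℓ) := by
  have h1 : Tendsto (fun n => dslope g 0 (u n)) atTop (𝓝 1) := by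
    have hc : ContinuousAt (dslope g 0) 0 := continuousAt_dslope_same.2 hg.differentiableAt
    have := hc.tendsto.comp hu
    rwa [dslope_same, hg.deriv] at this
  have h2 := hru.mul h1
  rw [mul_one] at h2
  refine h2.congr fun n => ?_
  have := sub_smul_dslope g 0 (u n)
  rw [hg0, sub_zero, sub_zero, smul_eq_mul] at this
  rw [mul_assoc, this]

lemma tendsto_mul_of_tendsto_mul_sin {r u : ℕ → ℝ} {ℓ : ℝ} (hu : Tendsto u atTop (𝓝 0))
    (hru : Tendsto (fun n => r n * Real.sin (u n)) atTop (𝓝 ℓ)) :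
    Tendsto (fun n => r n * u n) atTop (𝓝 ℓ) := by
  have hs : Tendsto (fun n => Real.sin (u n)) atTop (𝓝 0) := by
    have := (Real.continuous_sin.tendsto 0).comp hu
    rwa [Real.sin_zero] at this
  have hd : HasDerivAt Real.arcsin 1 0 := by
    simpa using Real.hasDerivAt_arcsin (x := 0) (by norm_num) (by norm_num)
  refine (tendsto_mul_comp Real.arcsin_zero hd hs hru).congr' ?_
  have hpi := Real.pi_pos
  filter_upwards [hu.eventually (Ioo_mem_nhds (a := -(Real.pi / 2)) (b := Real.pi / 2)
    (by linarith) (by linarith))] with n hn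
  rw [Real.arcsin_sin hn.1.le hn.2.le]

/-- Because `M ξ` is an even integer, `M n π ξ` is a multiple of `2π`. This is where the rationality
of `ξ₀`, `ξ₁` enters. -/
lemma tendsto_cos_mul {r : ℕ → ℝ} {M : ℕ}
    (hr : Tendsto (fun n : ℕ => r n - ((M * n : ℕ) : ℝ) * Real.pi) atTop (𝓝 0)) {ξ : ℝ} {k : ℕ}
    (hk : M * ξ = 2 * k) : Tendsto (fun n => Real.cos (r n * ξ)) atTop (𝓝 1) := by
  have h1 : Tendsto (fun n : ℕ => Real.cos ((r n - ((M * n : ℕ) : ℝ) * Real.pi) * ξ)) atTop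
      (𝓝 1) := by
    have := (Real.continuous_cos.tendsto 0).comp (by simpa using hr.mul_const ξ :
      Tendsto (fun n : ℕ => (r n - ((M * n : ℕ) : ℝ) * Real.pi) * ξ) atTop (𝓝 0))
    rwa [Real.cos_zero] at this
  refine h1.congr fun n => ?_
  rw [← Real.cos_add_nat_mul_two_pi _ (n * k)]
  congr 1
  push_cast
  linear_combination (-(n : ℝ) * Real.pi) * hk

section
variable (hq : ContinuousOn L.q (Icc 0 1)) (hξ₀ : L.ξ₀ ∈ Icc (0 : ℝ) 1) {r : ℕ → ℝ} {M : ℕ}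
  (hr1 : ∀ n, 1 ≤ r n) (hrtop : Tendsto r atTop atTop)
  (hr : Tendsto (fun n : ℕ => r n - ((M * n : ℕ) : ℝ) * Real.pi) atTop (𝓝 0))
include hq hr1 hrtop hr

lemma tendsto_solution {y : ℕ → ℝ → ℂ} (hy : ∀ᶠ n in atTop, L.IsSolution ((r n : ℂ) ^ 2) (y n))
    {a : ℂ} (ha : ∀ᶠ n in atTop, y n 0 = a) {c : ℝ} (hc : ∀ᶠ n in atTop, ‖D (y n) 0‖ ≤ c)
    {ξ : ℝ} (hξ : ξ ∈ Icc (0 : ℝ) 1) {k : ℕ} (hk : M * ξ = 2 * k) :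
    Tendsto (fun n => y n ξ) atTop (𝓝 a) := by
  obtain ⟨K, hK0, hK⟩ := exists_norm_sub_cos_le hq
  have h1 : Tendsto (fun n => y n ξ - a * (Real.cos (r n * ξ) : ℝ)) atTop (𝓝 0) := by
    have h2 : Tendsto (fun n => K * (‖a‖ + c) / r n) atTop (𝓝 0) :=
      Tendsto.const_div_atTop hrtop _
    refine squeeze_zero_norm' ?_ h2
    filter_upwards [hy, ha, hc] with n hn han hcn
    refine (han ▸ hK (r n) (hr1 n) (y n) hn ξ hξ).trans ?_
    have := hr1 n
    gcongr
  have h2 : Tendsto (fun n => a * ((Real.cos (r n * ξ) : ℝ) : ℂ)) atTop (𝓝 (a * (1 : ℝ))) :=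
    ((Complex.continuous_ofReal.tendsto 1).comp (tendsto_cos_mul hr hk)).const_mul a
  have := h1.add h2
  simpa using this

include hξ₀

lemma tendsto_C_S {k : ℕ} (hk : M * L.ξ₀ = 2 * k) :
    Tendsto (fun n => (L.C ((r n : ℂ) ^ 2) L.ξ₀).re) atTop (𝓝 1) ∧
      Tendsto (fun n => (L.S ((r n : ℂ) ^ 2) L.ξ₀).re) atTop (𝓝 0) := by
  constructor
  · have := tendsto_solution hq hr1 hrtop hr (y := fun n => L.C ((r n : ℂ) ^ 2)) (a := 1) (c := 0)
      (Eventually.of_forall fun n => (C_spec _ hq).1)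
      (Eventually.of_forall fun n => (C_spec _ hq).2.1)
      (Eventually.of_forall fun n => by rw [(C_spec _ hq).2.2, norm_zero]) hξ₀ hk
    exact (Complex.continuous_re.tendsto 1).comp this
  · have := tendsto_solution hq hr1 hrtop hr (y := fun n => L.S ((r n : ℂ) ^ 2)) (a := 0) (c := 1)
      (Eventually.of_forall fun n => (S_spec _ hq).1)
      (Eventually.of_forall fun n => (S_spec _ hq).2.1)
      (Eventually.of_forall fun n => by rw [(S_spec _ hq).2.2, norm_one]) hξ₀ hk
    exact (Complex.continuous_re.tendsto 0).comp this

lemma tendsto_ratio {k : ℕ} (hk : M * L.ξ₀ = 2 * k) :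
    Tendsto (fun n => L.ratio (r n)) atTop (𝓝 (L.γ₀ - L.h)) ∧
      ∀ᶠ n in atTop, 1 - L.γ₀ * (L.S ((r n : ℂ) ^ 2) L.ξ₀).re ≠ 0 := by
  obtain ⟨hC, hS⟩ := tendsto_C_S hq hξ₀ hr1 hrtop hr hk
  have hden : Tendsto (fun n => 1 - L.γ₀ * (L.S ((r n : ℂ) ^ 2) L.ξ₀).re) atTop (𝓝 1) := by
    simpa using (hS.const_mul L.γ₀).const_sub 1
  refine ⟨?_, hden.eventually_ne one_ne_zero⟩
  have := (((hC.const_mul L.γ₀).const_sub L.h).neg).div hden one_ne_zero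
  rw [mul_one, div_one, neg_sub] at this
  exact this

end

lemma arctan_aligned {ρ κ : ℝ} (hρ : 0 < ρ) :
    ρ * Real.sin (Real.arctan (-κ / ρ)) + κ * Real.cos (Real.arctan (-κ / ρ)) = 0 := by
  have hc := (Real.cos_arctan_pos (-κ / ρ)).ne'
  have ht := Real.tan_arctan (-κ / ρ)
  rw [Real.tan_eq_sin_div_cos, div_eq_div_iff hc hρ.ne'] at ht
  linear_combination ht

/-- Asymptotics of the eigenvalues `λ_m`, `m ∈ M ℕ`, and the Prüfer angles of their
eigenfunctions. -/
theorem IsEigenvalueSequence.exists_prufer (hq : ContDiffOn ℝ 1 L.q (Icc 0 1))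
    (hξ₀ : L.ξ₀ ∈ Icc (0 : ℝ) 1) (hξ₁ : L.ξ₁ ∈ Icc (0 : ℝ) 1) {lam : ℕ → ℂ}
    (hlam : L.IsEigenvalueSequence lam) {Q : ℝ → ℝ}
    (hQ : ∀ x ∈ Icc (0 : ℝ) 1, HasDerivWithinAt Q (L.q x) (Icc 0 1) x) (hQ0 : Q 0 = 0)
    (hQ1 : Q 1 = 0) {M k k₀ k₁ : ℕ} (hM : 0 < M) (hk : (M : ℝ) * 1 = 2 * k)
    (hk₀ : M * L.ξ₀ = 2 * k₀) (hk₁ : M * L.ξ₁ = 2 * k₁) :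
    ∃ (r : ℕ → ℝ) (θ : ℕ → ℝ → ℝ),
      (∀ᶠ n in atTop, ContinuousOn (θ n) (Icc 0 1) ∧ StrictMonoOn (θ n) (Icc 0 1)) ∧
      (∀ᶠ n in atTop, (∃ y, L.IsEigenfunction (lam (M * n)) y) ∧
        ∀ y, L.IsEigenfunction (lam (M * n)) y → ∀ x ∈ Icc (0 : ℝ) 1,
          (y x = 0 ↔ Real.cos (θ n x) = 0)) ∧
      (∃ K, ∀ n, ∀ x ∈ Icc (0 : ℝ) 1,
        |θ n x - θ n 0 - r n * x + Q x / (2 * r n)| ≤ K / r n ^ 2) ∧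
      (∀ n, 1 ≤ r n) ∧ Tendsto r atTop atTop ∧
      Tendsto (fun n : ℕ => r n * (r n - ((M * n : ℕ) : ℝ) * Real.pi)) atTop
        (𝓝 (L.H - L.h + L.γ₀ - L.γ₁)) ∧
      Tendsto (fun n => r n * θ n 0) atTop (𝓝 (L.h - L.γ₀)) := by
  have hqc := hq.continuousOn
  obtain ⟨B, hB0, hB⟩ := exists_abs_q_le hqc
  obtain ⟨K, N₀, hN₀⟩ := hlam.exists_sqrt hqc hξ₀ hξ₁
  -- The finitely many small indices get the default value `1`, so that `r n ≥ 1` holds for every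
  -- `n`.
  have hex (n : ℕ) : ∃ ρ : ℝ, 1 ≤ ρ ∧ (N₀ ≤ M * n → lam (M * n) = (ρ : ℂ) ^ 2 ∧
      L.charFun ((ρ : ℂ) ^ 2) = 0 ∧ ρ * |ρ - ((M * n : ℕ) : ℝ) * Real.pi| ≤ K) := by
    by_cases h : N₀ ≤ M * n
    · obtain ⟨ρ, h1, h2⟩ := hN₀ (M * n) h
      exact ⟨ρ, h1, fun _ => h2⟩
    · exact ⟨1, le_rfl, fun h' => absurd h' h⟩
  choose r hr1 hr2 using hex
  have hr0 (n : ℕ) : 0 < r n := one_pos.trans_le (hr1 n)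
  have hlarge : ∀ᶠ n in atTop, N₀ ≤ M * n := by
    filter_upwards [eventually_ge_atTop N₀] with n hn
    exact hn.trans (Nat.le_mul_of_pos_left n hM)
  have hMn : Tendsto (fun n : ℕ => ((M * n : ℕ) : ℝ) * Real.pi) atTop atTop := by
    refine Tendsto.atTop_mul_const Real.pi_pos (tendsto_natCast_atTop_atTop.comp ?_)
    exact tendsto_id.const_mul_atTop' hM
  have hdiff : ∀ᶠ n in atTop, |r n - ((M * n : ℕ) : ℝ) * Real.pi| ≤ K / r n := by
    filter_upwards [hlarge] with n hn
    rw [le_div_iff₀' (hr0 n)]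
    exact (hr2 n hn).2.2
  have hrtop : Tendsto r atTop atTop := by
    refine tendsto_atTop_mono' atTop ?_ (tendsto_atTop_add_const_right atTop (-K) hMn)
    filter_upwards [hlarge] with n hn
    have h1 := (hr2 n hn).2.2
    have h2 := neg_abs_le (r n - ((M * n : ℕ) : ℝ) * Real.pi)
    nlinarith [hr1 n, abs_nonneg (r n - ((M * n : ℕ) : ℝ) * Real.pi)]
  have hr : Tendsto (fun n : ℕ => r n - ((M * n : ℕ) : ℝ) * Real.pi) atTop (𝓝 0) :=
    squeeze_zero_norm' hdiff (Tendsto.const_div_atTop hrtop K)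
  obtain ⟨hratio, hne⟩ := tendsto_ratio hqc hξ₀ hr1 hrtop hr hk₀
  choose θ hθ0 hθ using fun n => exists_isPrufer hqc (hr0 n) (Real.arctan (-L.ratio (r n) / r n))
  obtain ⟨K', hK'0, hK'⟩ := exists_prufer_expansion hq hQ hQ0
  have hexp (n : ℕ) := hK' (r n) (hr1 n) (θ n) (hθ n)
  have hal {n : ℕ} {y : ℝ → ℂ} (hy : D y 0 = L.ratio (r n) * y 0) :
      r n * y 0 * (Real.sin (θ n 0) : ℝ) + D y 0 * (Real.cos (θ n 0) : ℝ) = 0 := by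
    have h1 : ((r n * Real.sin (θ n 0) + L.ratio (r n) * Real.cos (θ n 0) : ℝ) : ℂ) = 0 := by
      rw [hθ0, arctan_aligned (hr0 n), Complex.ofReal_zero]
    rw [hy]
    push_cast at h1 ⊢
    linear_combination y 0 * h1
  have hu : Tendsto (fun n => -L.ratio (r n) / r n) atTop (𝓝 0) := hratio.neg.div_atTop hrtop
  have hθlim : Tendsto (fun n => r n * θ n 0) atTop (𝓝 (L.h - L.γ₀)) := by
    have hd : HasDerivAt Real.arctan 1 0 := by simpa using Real.hasDerivAt_arctan 0
    have h1 : Tendsto (fun n => r n * (-L.ratio (r n) / r n)) atTop (𝓝 (L.h - L.γ₀)) := by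
      have h2 := hratio.neg
      rw [neg_sub] at h2
      exact h2.congr fun n => (mul_div_cancel₀ _ (hr0 n).ne').symm
    refine (tendsto_mul_comp Real.arctan_zero hd hu h1).congr fun n => ?_
    rw [hθ0]
  have hθ0lim : Tendsto (fun n => θ n 0) atTop (𝓝 0) := by
    have := (Real.continuous_arctan.tendsto 0).comp hu
    rw [Real.arctan_zero] at this
    exact this.congr fun n => (hθ0 n).symm
  have he1 (n : ℕ) : |θ n 1 - θ n 0 - r n| ≤ K' / r n ^ 2 := by
    have := hexp n 1 one_mem
    rwa [hQ1, zero_div, add_zero, mul_one] at this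
  have he1lim : Tendsto (fun n => r n * (θ n 1 - θ n 0 - r n)) atTop (𝓝 0) := by
    refine squeeze_zero_norm (a := fun n => K' / r n) (fun n => ?_)
      (Tendsto.const_div_atTop hrtop K')
    rw [norm_mul, Real.norm_of_nonneg (hr0 n).le, Real.norm_eq_abs]
    calc r n * |θ n 1 - θ n 0 - r n| ≤ r n * (K' / r n ^ 2) := by
          have := hr0 n
          gcongr
          exact he1 n
      _ = K' / r n := by
          have := (hr0 n).ne'
          field_simp
  have hδ : Tendsto (fun n : ℕ => θ n 1 - ((M * n : ℕ) : ℝ) * Real.pi) atTop (𝓝 0) := by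
    have h1 : Tendsto (fun n => θ n 1 - θ n 0 - r n) atTop (𝓝 0) := by
      refine squeeze_zero_norm (fun n => ?_) (tendsto_zero_iff_norm_tendsto_zero.1 he1lim)
      rw [norm_mul, Real.norm_of_nonneg (hr0 n).le]
      exact le_mul_of_one_le_left (norm_nonneg _) (hr1 n)
    have := (h1.add hθ0lim).add hr
    simp only [add_zero] at this
    exact this.congr fun n => by ring
  -- As `M` is even, the shift is by full periods and no sign appears.
  have hsincos (n : ℕ) : Real.sin (θ n 1) = Real.sin (θ n 1 - ((M * n : ℕ) : ℝ) * Real.pi) ∧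
      Real.cos (θ n 1) = Real.cos (θ n 1 - ((M * n : ℕ) : ℝ) * Real.pi) := by
    have e : θ n 1 = θ n 1 - ((M * n : ℕ) : ℝ) * Real.pi + ((k * n : ℕ) : ℝ) * (2 * Real.pi) := by
      push_cast
      linear_combination (n : ℝ) * Real.pi * hk
    constructor
    · nth_rewrite 1 [e]
      exact Real.sin_add_nat_mul_two_pi _ _
    · nth_rewrite 1 [e]
      exact Real.cos_add_nat_mul_two_pi _ _
  -- Alignment at `1` and the right condition give `ρ sin θ(1) = (H y(1) - γ₁ y(ξ₁)) / y(1) * cos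
  -- θ(1)`, where both values of `y` and the cosine tend to `1`.
  have hend : Tendsto (fun n : ℕ => r n * (θ n 1 - ((M * n : ℕ) : ℝ) * Real.pi)) atTop
      (𝓝 (L.H - L.γ₁)) := by
    have hey (n : ℕ) : ∃ y : ℝ → ℂ, (N₀ ≤ M * n → 1 - L.γ₀ * (L.S ((r n : ℂ) ^ 2) L.ξ₀).re ≠ 0 →
        L.IsEigenfunction ((r n : ℂ) ^ 2) y ∧ y 0 = 1 ∧ D y 0 = L.ratio (r n)) := by
      by_cases h : N₀ ≤ M * n ∧ 1 - L.γ₀ * (L.S ((r n : ℂ) ^ 2) L.ξ₀).re ≠ 0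
      · obtain ⟨y, hy⟩ := exists_isEigenfunction hqc hξ₀ h.2 (hr2 n h.1).2.1
        exact ⟨y, fun _ _ => hy⟩
      · exact ⟨0, fun h1 h2 => absurd ⟨h1, h2⟩ h⟩
    choose y hy using hey
    have hy' : ∀ᶠ n in atTop,
        L.IsEigenfunction ((r n : ℂ) ^ 2) (y n) ∧ y n 0 = 1 ∧ D (y n) 0 = L.ratio (r n) := by
      filter_upwards [hlarge, hne] with n h1 h2 using hy n h1 h2
    have hbdd : ∀ᶠ n in atTop, ‖D (y n) 0‖ ≤ |L.γ₀ - L.h| + 1 := by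
      filter_upwards [hy', hratio.abs.eventually (gt_mem_nhds (lt_add_one |L.γ₀ - L.h|))] with n h1 h2
      rw [h1.2.2, Complex.norm_real]
      exact h2.le
    have hlimy {ξ : ℝ} (hξ : ξ ∈ Icc (0 : ℝ) 1) {j : ℕ} (hj : M * ξ = 2 * j) :
        Tendsto (fun n => y n ξ) atTop (𝓝 1) :=
      tendsto_solution hqc hr1 hrtop hr (hy'.mono fun n h => h.1.sol) (hy'.mono fun n h => h.2.1)
        hbdd hξ hj
    have hy1 := hlimy one_mem hk
    have hyξ := hlimy hξ₁ hk₁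
    have hcos : Tendsto (fun n => ((Real.cos (θ n 1) : ℝ) : ℂ)) atTop (𝓝 (1 : ℝ)) := by
      refine (Complex.continuous_ofReal.tendsto 1).comp ?_
      have := (Real.continuous_cos.tendsto 0).comp hδ
      rw [Real.cos_zero] at this
      exact this.congr fun n => (hsincos n).2.symm
    have h1 : Tendsto (fun n => (L.H * y n 1 - L.γ₁ * y n L.ξ₁) / y n 1 *
        ((Real.cos (θ n 1) : ℝ) : ℂ)) atTop (𝓝 ((L.H * 1 - L.γ₁ * 1) / 1 * (1 : ℝ))) :=
      (((hy1.const_mul _).sub (hyξ.const_mul _)).div hy1 one_ne_zero).mul hcos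
    have h2 : Tendsto (fun n => ((r n * Real.sin (θ n 1) : ℝ) : ℂ)) atTop
        (𝓝 ((L.H * 1 - L.γ₁ * 1) / 1 * (1 : ℝ))) := by
      refine h1.congr' ?_
      filter_upwards [hy', hy1.eventually_ne one_ne_zero] with n hn hn1
      have h3 := (hθ n).aligned hqc (hr0 n) hn.1.sol (hal (by rw [hn.2.2, hn.2.1, mul_one])) one_mem
      have h4 := hn.1.right
      rw [V] at h4
      rw [div_mul_eq_mul_div, div_eq_iff hn1]
      push_cast at h3 ⊢
      linear_combination -h3 + Complex.cos (θ n 1) * h4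
    have h3 := (Complex.continuous_re.tendsto _).comp h2
    refine tendsto_mul_of_tendsto_mul_sin hδ ?_
    have h4 : ((L.H * 1 - L.γ₁ * 1) / 1 * (1 : ℝ) : ℂ).re = L.H - L.γ₁ := by simp
    rw [h4] at h3
    refine h3.congr fun n => ?_
    rw [← (hsincos n).1, Function.comp_apply, Complex.ofReal_re]
  refine ⟨r, θ, ?_, ?_, ⟨K', hexp⟩, hr1, hrtop, ?_, hθlim⟩
  · filter_upwards [hrtop.eventually_gt_atTop B] with n hn
    refine ⟨(hθ n).continuousOn, (hθ n).strictMonoOn hB (hr0 n) ?_⟩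
    nlinarith [hr1 n]
  · filter_upwards [hlarge, hne] with n hn hn'
    obtain ⟨h1, h2, -⟩ := hr2 n hn
    rw [h1]
    obtain ⟨y, hy, -⟩ := exists_isEigenfunction hqc hξ₀ hn' h2
    refine ⟨⟨y, hy⟩, fun z hz x hx => ?_⟩
    obtain ⟨h3, h4⟩ := hz.D_zero_eq hqc hξ₀ hn'
    exact (hθ n).zero_iff hqc (hr0 n) hz.sol (hal h3) h4 hx
  -- `ρ - m π` is `θ(1) - m π`, minus `θ(0)`, minus the error of the expansion at `1`.
  · have := (hend.sub hθlim).sub he1lim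
    rw [sub_zero] at this
    refine (this.congr fun n => by ring).trans_eq ?_
    congr 1
    ring

end NonlocalSL

/-! ### Nodal points -/

namespace NonlocalSL

variable {L : NonlocalSL}

lemma exists_primitive (hq : ContinuousOn L.q (Icc 0 1)) (hmean : ∫ x in (0 : ℝ)..1, L.q x = 0) :
    ∃ Q : ℝ → ℝ, (∀ x ∈ Icc (0 : ℝ) 1, HasDerivWithinAt Q (L.q x) (Icc 0 1) x) ∧
      Q 0 = 0 ∧ Q 1 = 0 := by
  have hc : Continuous (IccExtend (zero_le_one' ℝ) (domRestrict (Icc 0 1) L.q)) :=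
    hq.domRestrict.Icc_extend'
  have he {x : ℝ} (hx : x ∈ Icc (0 : ℝ) 1) :
      IccExtend (zero_le_one' ℝ) (domRestrict (Icc 0 1) L.q) x = L.q x := IccExtend_of_mem _ _ hx
  refine ⟨fun x => ∫ t in (0 : ℝ)..x, IccExtend (zero_le_one' ℝ) (domRestrict (Icc 0 1) L.q) t,
    fun x hx => ?_, intervalIntegral.integral_same, ?_⟩
  · rw [← he hx]
    exact (intervalIntegral.integral_hasDerivAt_right (hc.intervalIntegrable _ _)
      (hc.stronglyMeasurableAtFilter _ _) hc.continuousAt).hasDerivWithinAt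
  · refine Eq.trans (intervalIntegral.integral_congr fun x hx => ?_) hmean
    rw [uIcc_of_le zero_le_one] at hx
    exact he hx

/-- Asymptotic information on the eigenfunctions for `λ_m`, `m = M n`: their zeros are the zeros
of `cos (θ n ·)`, and `θ n` has a two term expansion. -/
structure PruferData (L : NonlocalSL) (lam : ℕ → ℂ) (M : ℕ) (Q : ℝ → ℝ) (r : ℕ → ℝ)
    (θ : ℕ → ℝ → ℝ) : Prop where
  regular : ∀ᶠ n in atTop, ContinuousOn (θ n) (Icc 0 1) ∧ StrictMonoOn (θ n) (Icc 0 1)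
  exists_eigenfunction : ∀ᶠ n in atTop, ∃ y, L.IsEigenfunction (lam (M * n)) y
  zero_iff : ∀ᶠ n in atTop, ∀ y, L.IsEigenfunction (lam (M * n)) y → ∀ x ∈ Icc (0 : ℝ) 1,
    (y x = 0 ↔ Real.cos (θ n x) = 0)
  expansion : ∃ K, ∀ n, ∀ x ∈ Icc (0 : ℝ) 1,
    |θ n x - θ n 0 - r n * x + Q x / (2 * r n)| ≤ K / r n ^ 2
  one_le : ∀ n, 1 ≤ r n
  tendsto_atTop : Tendsto r atTop atTop
  tendsto_mul_sub : Tendsto (fun n : ℕ => r n * (r n - ((M * n : ℕ) : ℝ) * Real.pi)) atTop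
    (𝓝 (L.H - L.h + L.γ₀ - L.γ₁))
  tendsto_mul_zero : Tendsto (fun n => r n * θ n 0) atTop (𝓝 (L.h - L.γ₀))

namespace PruferData

variable {lam : ℕ → ℂ} {M : ℕ} {Q : ℝ → ℝ} {r : ℕ → ℝ} {θ : ℕ → ℝ → ℝ}

lemma tendsto_sub (h : L.PruferData lam M Q r θ) :
    Tendsto (fun n : ℕ => r n - ((M * n : ℕ) : ℝ) * Real.pi) atTop (𝓝 0) := by
  refine (h.tendsto_mul_sub.div_atTop h.tendsto_atTop).congr fun n => ?_
  have : r n ≠ 0 := (one_pos.trans_le (h.one_le n)).ne'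
  exact mul_div_cancel_left₀ _ this

lemma tendsto_zero (h : L.PruferData lam M Q r θ) : Tendsto (fun n => θ n 0) atTop (𝓝 0) := by
  refine (h.tendsto_mul_zero.div_atTop h.tendsto_atTop).congr fun n => ?_
  have : r n ≠ 0 := (one_pos.trans_le (h.one_le n)).ne'
  exact mul_div_cancel_left₀ _ this

/-- A crude uniform form of the expansion, used for density: any bound below `π / 2` guarantees that
the levels `(j + 1/2) π` with `j < m` are attained inside `(0,1)`. -/
lemma eventually_close (h : L.PruferData lam M Q r θ) (hQ : ContinuousOn Q (Icc 0 1)) :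
    ∀ᶠ n : ℕ in atTop, ∀ x ∈ Icc (0 : ℝ) 1, |θ n x - ((M * n : ℕ) : ℝ) * Real.pi * x| ≤ 1 := by
  obtain ⟨K, hK⟩ := h.expansion
  obtain ⟨B, hB⟩ := isCompact_Icc.exists_bound_of_continuousOn hQ
  have hsq : Tendsto (fun n => r n ^ 2) atTop atTop :=
    (tendsto_pow_atTop two_ne_zero).comp h.tendsto_atTop
  have hlim : Tendsto (fun n : ℕ => K / r n ^ 2 + |θ n 0| +
      |r n - ((M * n : ℕ) : ℝ) * Real.pi| + B / r n) atTop (𝓝 0) := by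
    simpa using (((Tendsto.const_div_atTop hsq K).add h.tendsto_zero.abs).add
      h.tendsto_sub.abs).add (Tendsto.const_div_atTop h.tendsto_atTop B)
  filter_upwards [hlim.eventually (gt_mem_nhds one_pos)] with n hn x hx
  have hr0 : 0 < r n := one_pos.trans_le (h.one_le n)
  have e : θ n x - ((M * n : ℕ) : ℝ) * Real.pi * x =
      (θ n x - θ n 0 - r n * x + Q x / (2 * r n)) + θ n 0 +
        (r n - ((M * n : ℕ) : ℝ) * Real.pi) * x - Q x / (2 * r n) := by ring
  have h1 : |(r n - ((M * n : ℕ) : ℝ) * Real.pi) * x| ≤ |r n - ((M * n : ℕ) : ℝ) * Real.pi| := by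
    rw [abs_mul]
    exact mul_le_of_le_one_right (abs_nonneg _) ((abs_of_nonneg hx.1).trans_le hx.2)
  have h2 : |Q x / (2 * r n)| ≤ B / r n := by
    rw [abs_div, abs_of_pos (a := 2 * r n) (by positivity)]
    have hB0 : 0 ≤ B := (norm_nonneg _).trans (hB x hx)
    gcongr
    · exact hB x hx
    · linarith
  rw [e]
  refine (abs_sub _ _).trans ((add_le_add (abs_add_three _ _ _) h2).trans ?_)
  linarith [hK n x hx]

lemma eventually_zero_lt (h : L.PruferData lam M Q r θ) :
    ∀ᶠ n : ℕ in atTop, |θ n 0| < Real.pi / 2 := by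
  have := h.tendsto_zero.abs
  rw [abs_zero] at this
  exact this.eventually (gt_mem_nhds (by positivity))

/-- A node lies at some level `(k + 1/2) π`; it then has exactly `k` zeros to its left, so `k` is
its label. -/
lemma eventually_angle_eq (h : L.PruferData lam M Q r θ) :
    ∀ᶠ n : ℕ in atTop, ∀ j t, (M * n, j, t) ∈ L.nodalPoints lam →
      t ∈ Ioo (0 : ℝ) 1 ∧ θ n t = (j + 1 / 2) * Real.pi := by
  filter_upwards [h.regular, h.zero_iff, h.eventually_zero_lt] with n h1 h2 h3 j t hP
  obtain ⟨y, hy, ht, hyt, hcard⟩ := hP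
  dsimp only at hy ht hyt hcard
  have hiff := h2 y hy
  obtain ⟨k, hk⟩ := exists_nat_of_cos_eq_zero h1.2 h3 ht ((hiff t (Ioo_subset_Icc_self ht)).1 hyt)
  have hk' := encard_zeros h1.1 h1.2 h3 ht hk
  have hset : {s : ℝ | s ∈ Ioo (0 : ℝ) t ∧ y s = 0} =
      {s : ℝ | s ∈ Ioo (0 : ℝ) t ∧ Real.cos (θ n s) = 0} := by
    ext s
    exact and_congr_right fun hs => hiff s ⟨hs.1.le, (hs.2.trans ht.2).le⟩
  rw [hset, hk'] at hcard
  have : k = j := by exact_mod_cast hcard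
  exact ⟨ht, this ▸ hk⟩

lemma eventually_mem_nodalPoints (h : L.PruferData lam M Q r θ) :
    ∀ᶠ n : ℕ in atTop, ∀ (j : ℕ) (t : ℝ), t ∈ Ioo (0 : ℝ) 1 → θ n t = (j + 1 / 2) * Real.pi →
      (M * n, j, t) ∈ L.nodalPoints lam := by
  filter_upwards [h.regular, h.exists_eigenfunction, h.zero_iff, h.eventually_zero_lt] with
    n h1 ⟨y, hy⟩ h2 h3 j t ht hj
  have hiff := h2 y hy
  refine ⟨y, hy, ht, ?_, ?_⟩
  · rw [hiff t (Ioo_subset_Icc_self ht), hj]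
    exact cos_nat_add_half_mul_pi j
  · have hset : {s : ℝ | s ∈ Ioo (0 : ℝ) t ∧ y s = 0} =
        {s : ℝ | s ∈ Ioo (0 : ℝ) t ∧ Real.cos (θ n s) = 0} := by
      ext s
      exact and_congr_right fun hs => hiff s ⟨hs.1.le, (hs.2.trans ht.2).le⟩
    exact hset ▸ encard_zeros h1.1 h1.2 h3 ht hj

/-- The nodal points are dense. -/
theorem nodalDense (h : L.PruferData lam M Q r θ) (hQ : ContinuousOn Q (Icc 0 1)) (hM : 0 < M) :
    NodalDense (L.nodalPoints lam) M := by
  intro x hx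
  have hpi := Real.pi_gt_three
  have hstep : ∀ᶠ n : ℕ in atTop, ∃ (j : ℕ) (t : ℝ), (M * n, j, t) ∈ L.nodalPoints lam ∧
      |t - x| ≤ 3 / n := by
    filter_upwards [h.regular, h.eventually_mem_nodalPoints, h.eventually_close hQ,
      eventually_gt_atTop 0] with n h1 h2 h3 hn
    set m := M * n with hm
    have hm0 : 0 < m := Nat.mul_pos hM hn
    have hm1 : (1 : ℝ) ≤ m := by exact_mod_cast hm0
    -- At `x = 1` the floor would be `m`, whose level lies above `θ(1)`; there `m - 1` is taken
    -- instead.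
    obtain ⟨j, hjm, hjx⟩ : ∃ j : ℕ, (j : ℝ) + 1 ≤ m ∧ |(j : ℝ) - m * x| ≤ 1 := by
      have hmx : 0 ≤ (m : ℝ) * x := mul_nonneg (by positivity) hx.1
      rcases hx.2.lt_or_eq with hlt | rfl
      · refine ⟨⌊(m : ℝ) * x⌋₊, ?_, ?_⟩
        · have : ⌊(m : ℝ) * x⌋₊ < m := (Nat.floor_lt hmx).2 (by nlinarith)
          exact_mod_cast this
        · have h4 := Nat.floor_le hmx
          have h5 := Nat.lt_floor_add_one ((m : ℝ) * x)
          rw [abs_le]; constructor <;> linarith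
      · refine ⟨m - 1, ?_, ?_⟩ <;> rw [Nat.cast_sub hm0, Nat.cast_one]
        · linarith
        · rw [mul_one, sub_sub_cancel_left, abs_neg, abs_one]
    have h01 := abs_le.1 (h3 0 zero_mem)
    have h11 := abs_le.1 (h3 1 one_mem)
    have hmem : ((j : ℝ) + 1 / 2) * Real.pi ∈ Ioo (θ n 0) (θ n 1) := by
      constructor
      · nlinarith [(Nat.cast_nonneg j : (0 : ℝ) ≤ j)]
      · nlinarith
    obtain ⟨t, ht, htv⟩ := intermediate_value_Ioo zero_le_one h1.1 hmem
    refine ⟨j, t, h2 j t ht htv, ?_⟩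
    have h4 := h3 t (Ioo_subset_Icc_self ht)
    rw [htv] at h4
    have hmn : (n : ℝ) ≤ m := by
      have : n ≤ m := Nat.le_mul_of_pos_left n hM
      exact_mod_cast this
    have hn0 : (0 : ℝ) < n := by exact_mod_cast hn
    have h5 : |((j : ℝ) + 1 / 2) - m * t| ≤ 1 := by
      have e : ((j : ℝ) + 1 / 2) * Real.pi - m * Real.pi * t =
          (((j : ℝ) + 1 / 2) - m * t) * Real.pi := by ring
      rw [e, abs_mul, abs_of_pos Real.pi_pos] at h4
      nlinarith [abs_nonneg (((j : ℝ) + 1 / 2) - m * t)]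
    have h6 : m * |t - x| ≤ 3 := by
      rw [abs_le] at h5 hjx
      rw [← abs_of_pos (a := (m : ℝ)) (by linarith), ← abs_mul, abs_le]
      constructor <;> nlinarith
    rw [le_div_iff₀' hn0]
    exact (mul_le_mul_of_nonneg_right hmn (abs_nonneg _)).trans h6
  obtain ⟨N, hN⟩ := eventually_atTop.1 hstep
  choose j t hmem hclose using fun i : ℕ => hN (i + N) (Nat.le_add_left N i)
  have htop : Tendsto (fun i => i + N) atTop atTop := tendsto_add_atTop_nat N
  refine ⟨fun i => i + N, j, t, hmem, htop, ?_⟩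
  refine tendsto_iff_norm_sub_tendsto_zero.2 (squeeze_zero (fun _ => norm_nonneg _) hclose ?_)
  exact Tendsto.const_div_atTop (tendsto_natCast_atTop_atTop.comp htop) 3

/-- The limit of the rescaled nodal points. -/
theorem isNodalLimit (h : L.PruferData lam M Q r θ) (hQ : ContinuousOn Q (Icc 0 1)) (hM : 0 < M)
    {X₀ : Set (ℕ × ℕ × ℝ)} (hX₀ : X₀ ⊆ L.nodalPoints lam) :
    IsNodalLimit X₀ M fun x => Q x / 2 + (L.γ₀ - L.h) - (L.H - L.h + L.γ₀ - L.γ₁) * x := by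
  intro x hx n j t happ
  obtain ⟨K, hK⟩ := h.expansion
  have hang : ∀ᶠ i in atTop, t i ∈ Ioo (0 : ℝ) 1 ∧ θ (n i) (t i) = (j i + 1 / 2) * Real.pi := by
    filter_upwards [happ.index.eventually h.eventually_angle_eq] with i hi
    exact hi _ _ (hX₀ (happ.mem i))
  have hpos : ∀ᶠ i in atTop, 0 < n i := happ.index.eventually (eventually_gt_atTop 0)
  have hrt : Tendsto (fun i => r (n i)) atTop atTop := h.tendsto_atTop.comp happ.index
  have hr0 (k : ℕ) : r k ≠ 0 := (one_pos.trans_le (h.one_le k)).ne'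
  have hquot : Tendsto (fun i => ((M * n i : ℕ) : ℝ) * Real.pi / r (n i)) atTop (𝓝 1) := by
    have h1 : Tendsto (fun i => 1 - (r (n i) - ((M * n i : ℕ) : ℝ) * Real.pi) / r (n i)) atTop
        (𝓝 (1 - 0)) := ((h.tendsto_sub.comp happ.index).div_atTop hrt).const_sub 1
    rw [sub_zero] at h1
    refine h1.congr fun i => ?_
    have := hr0 (n i)
    field_simp
    ring
  have hQt : Tendsto (fun i => Q (t i)) atTop (𝓝 (Q x)) := by
    refine (hQ x hx).tendsto.comp (tendsto_nhdsWithin_iff.2 ⟨happ.lim, ?_⟩)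
    exact hang.mono fun i hi => Ioo_subset_Icc_self hi.1
  have herr : Tendsto (fun i => r (n i) * (θ (n i) (t i) - θ (n i) 0 - r (n i) * t i +
      Q (t i) / (2 * r (n i)))) atTop (𝓝 0) := by
    refine squeeze_zero_norm' ?_ (Tendsto.const_div_atTop hrt K)
    filter_upwards [hang] with i hi
    have hp : 0 < r (n i) := one_pos.trans_le (h.one_le _)
    rw [norm_mul, Real.norm_of_nonneg hp.le, Real.norm_eq_abs]
    calc _ ≤ r (n i) * (K / r (n i) ^ 2) := by
          gcongr
          exact hK _ _ (Ioo_subset_Icc_self hi.1)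
      _ = _ := by field_simp
  -- With `θ(t) = (j + 1/2) π`, the rescaled node is exactly `(m π / ρ) * (-ρ (ρ - m π) t - ρ θ(0) +
  -- Q(t) / 2 - ρ * err)`, where `err` is the expansion error.
  have hlim := hquot.mul (((((h.tendsto_mul_sub.comp happ.index).mul happ.lim).neg.sub
    (h.tendsto_mul_zero.comp happ.index)).add (hQt.div_const 2)).sub herr)
  have hval : 1 * (-((L.H - L.h + L.γ₀ - L.γ₁) * x) - (L.h - L.γ₀) + Q x / 2 - 0) =
      Q x / 2 + (L.γ₀ - L.h) - (L.H - L.h + L.γ₀ - L.γ₁) * x := by ring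
  rw [hval] at hlim
  refine hlim.congr' ?_
  filter_upwards [hang, hpos] with i hi hni
  have hm : ((M * n i : ℕ) : ℝ) ≠ 0 := by
    exact_mod_cast (Nat.mul_pos hM hni).ne'
  have hrn := hr0 (n i)
  rw [hi.2]
  simp only [Function.comp_apply]
  field_simp
  ring

end PruferData

end NonlocalSL

end

/-! ### Reconstruction from a dense set of nodes -/

theorem mainTheorem2 (L : NonlocalSL)
    (hq : ContDiffOn ℝ 1 L.q (Icc 0 1)) (hmean : ∫ x in (0 : ℝ)..1, L.q x = 0)
    (hγ₀ : L.γ₀ ≠ 0) (hγ₁ : L.γ₁ ≠ 0)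
    (p₀ r₀ p₁ r₁ : ℕ)
    (hξ₀ : L.ξ₀ = (p₀ : ℝ) / r₀) (hξ₀' : L.ξ₀ ∈ Ioo (0 : ℝ) 1)
    (hξ₁ : L.ξ₁ = (p₁ : ℝ) / r₁) (hξ₁' : L.ξ₁ ∈ Ioo (0 : ℝ) 1) :
    (∃ lam : ℕ → ℂ, L.IsEigenvalueSequence lam) ∧
    ∀ lam : ℕ → ℂ, L.IsEigenvalueSequence lam →
      NodalDense (L.nodalPoints lam) (2 * r₀ * r₁) ∧
      ∀ X₀ : Set (ℕ × ℕ × ℝ), X₀ ⊆ L.nodalPoints lam → NodalDense X₀ (2 * r₀ * r₁) →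
        (∃ f : ℝ → ℝ, IsNodalLimit X₀ (2 * r₀ * r₁) f) ∧
        ∀ f : ℝ → ℝ, IsNodalLimit X₀ (2 * r₀ * r₁) f →
          DifferentiableOn ℝ f (Icc 0 1) ∧
          (∀ x ∈ Icc (0 : ℝ) 1, L.q x = 2 * (derivWithin f (Icc 0 1) x + f 0 - f 1)) ∧
          L.γ₀ - L.h = f 0 ∧
          L.γ₁ - L.H = f 1 ∧
          (L.γ₀ = L.h + f 0 ∧ L.γ₁ = L.H + f 1) ∧
          (L.h = L.γ₀ - f 0 ∧ L.H = L.γ₁ - f 1) := by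
  have hI₀ := Ioo_subset_Icc_self hξ₀'
  have hI₁ := Ioo_subset_Icc_self hξ₁'
  refine ⟨NonlocalSL.exists_isEigenvalueSequence hq.continuousOn hI₀ hI₁, fun lam hlam => ?_⟩
  -- Division by zero would give `ξ₀ = 0`, outside the open interval.
  have hr₀ : (r₀ : ℝ) ≠ 0 := fun h => by
    rw [h, div_zero] at hξ₀
    exact hξ₀'.1.ne' hξ₀
  have hr₁ : (r₁ : ℝ) ≠ 0 := fun h => by
    rw [h, div_zero] at hξ₁
    exact hξ₁'.1.ne' hξ₁
  have hM : 0 < 2 * r₀ * r₁ := by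
    have h0 : 0 < r₀ := Nat.pos_of_ne_zero (by exact_mod_cast hr₀)
    have h1 : 0 < r₁ := Nat.pos_of_ne_zero (by exact_mod_cast hr₁)
    positivity
  obtain ⟨Q, hQ, hQ0, hQ1⟩ := NonlocalSL.exists_primitive hq.continuousOn hmean
  obtain ⟨r, θ, h1, h2, h3, h4, h5, h6, h7⟩ := hlam.exists_prufer hq hI₀ hI₁ hQ hQ0 hQ1
    (M := 2 * r₀ * r₁) (k := r₀ * r₁) (k₀ := p₀ * r₁) (k₁ := p₁ * r₀) hM
    (by push_cast; ring) (by rw [hξ₀]; push_cast; field_simp) (by rw [hξ₁]; push_cast; field_simp)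
  have hdata : L.PruferData lam (2 * r₀ * r₁) Q r θ :=
    ⟨h1, h2.mono fun _ h => h.1, h2.mono fun _ h => h.2, h3, h4, h5, h6, h7⟩
  have hQc : ContinuousOn Q (Icc 0 1) := fun x hx => (hQ x hx).continuousWithinAt
  refine ⟨hdata.nodalDense hQc hM, fun X₀ hX₀ hdense => ?_⟩
  have hlim := hdata.isNodalLimit hQc hM hX₀
  refine ⟨⟨_, hlim⟩, fun f hf => ?_⟩
  -- Density supplies a nodal sequence at each `x`, along which uniqueness of limits determines `f
  -- x`.
  have hf_eq : ∀ x ∈ Icc (0 : ℝ) 1,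
      f x = Q x / 2 + (L.γ₀ - L.h) - (L.H - L.h + L.γ₀ - L.γ₁) * x := by
    intro x hx
    obtain ⟨n, j, t, happ⟩ := hdense x hx
    exact tendsto_nhds_unique (hf x hx n j t happ) (hlim x hx n j t happ)
  have hf0 : f 0 = L.γ₀ - L.h := by
    rw [hf_eq 0 NonlocalSL.zero_mem, hQ0]; ring
  have hf1 : f 1 = L.γ₁ - L.H := by
    rw [hf_eq 1 NonlocalSL.one_mem, hQ1]; ring
  have hderiv : ∀ x ∈ Icc (0 : ℝ) 1, HasDerivWithinAt f
      (L.q x / 2 - (L.H - L.h + L.γ₀ - L.γ₁)) (Icc 0 1) x := by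
    intro x hx
    refine HasDerivWithinAt.congr (f := fun x => Q x / 2 + (L.γ₀ - L.h) -
      (L.H - L.h + L.γ₀ - L.γ₁) * x) ?_ hf_eq (hf_eq x hx)
    refine ((((hQ x hx).div_const 2).add_const _).sub
      ((hasDerivWithinAt_id x _).const_mul _)).congr_deriv ?_
    rw [mul_one]
  refine ⟨fun x hx => (hderiv x hx).differentiableWithinAt, fun x hx => ?_, hf0.symm, hf1.symm,
    ⟨by rw [hf0]; ring, by rw [hf1]; ring⟩, by rw [hf0]; ring, by rw [hf1]; ring⟩
  rw [(hderiv x hx).derivWithin (NonlocalSL.uniqueDiffWithinAt_Icc hx), hf0, hf1]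
  ring
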